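/- Let $\mathcal A$ be a nondeterministic finite automaton (NFA) over a finite alphabet $\Sigma$, with a finite state set, a transition function $\delta:Q\times\Sigma\to 2^Q$, and sets of initial and accepting states; let $\mathfrak L(\mathcal A)$ be its language and let $\mathfrak J(\mathcal A)$ be its jumping language, i.e. the set of words some permutation of which lies in $\mathfrak L(\mathcal A)$. A jump sequence for a word $w=w_1\cdots w_n$ is a vector $\vec a=(a_0,a_1,\dots,a_n,a_{n+1})$ with $a_0=0$, $a_{n+1}=n+1$ and $(a_1,\dots,a_n)$ a permutation of $\{1,\dots,n\}$; put $w_{\vec a}=w_{a_1}\cdots w_{a_n}$ and $[\![\vec a]\!]=\sum_{i=1}^{n+1}(|a_i-a_{i-1}|-1)$. The absolute-distance cost of $w$ is $$\mathcal A_{\mathrm{abs}}(w)=\min\{[\![\vec a]\!] : \vec a \text{ a jump sequence for } w \text{ with } w_{\vec a}\in\mathfrak L(\mathcal A)\},\qquad \min\emptyset=\infty.$$ Then: 1. There is an algorithm that, given $\mathcal A$ and $k\in\mathbb N$, constructs an NFA $\mathcal B$ over the same alphabet with $\mathfrak L(\mathcal B)=\{w\in\Sigma^*\mid \mathcal A_{\mathrm{abs}}(w)\le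 k\}$. 2. The following four problems are decidable: - $k$-Bnd (for each fixed $k\in\mathbb N$): given $\mathcal A$, decide whether $\mathcal A_{\mathrm{abs}}(w)\le k$ for all $w\in\mathfrak J(\mathcal A)$; - Param-Bnd: given $\mathcal A$ and $k\in\mathbb N$, decide whether $\mathcal A_{\mathrm{abs}}(w)\le k$ for all $w\in\mathfrak J(\mathcal A)$; - Univ-$k$-Bnd (for each fixed $k\in\mathbb N$): given $\mathcal A$, decide whether $\mathcal A_{\mathrm{abs}}(w)\le k$ for all $w\in\Sigma^*$; - Univ-Param-Bnd: given $\mathcal A$ and $k\in\mathbb N$, decide whether $\mathcal A_{\mathrm{abs}}(w)\le k$ for all $w\in\Sigma^*$. -/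

import Mathlib

/-! Jumping finite automata are Mathlib's `NFA`s read through a jumping head. -/

/-- The jumping language of `M`: the words some permutation of which is accepted by `M`. -/
def jumpingLanguage {α σ : Type*} (M : NFA α σ) : Language α :=
  {w | ∃ u : List α, w.Perm u ∧ u ∈ M.accepts}

/-- The jump sequence `(a₀, a₁, …, aₙ, aₙ₊₁)` given by a permutation `π` of the `n` positions:
`a₀ = 0`, `aₙ₊₁ = n + 1`, and `aᵢ₊₁ = π i + 1` (positions in `Fin n` start at `0`, indices of
letters in a jump sequence start at `1`). -/
def jumpSeq {n : ℕ} (π : Equiv.Perm (Fin n)) : Fin (n + 2) → ℤ :=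
  Fin.cons (α := fun _ => ℤ) 0
    (Fin.snoc (α := fun _ => ℤ) (fun i : Fin n => ((π i : ℕ) : ℤ) + 1) ((n : ℤ) + 1))

/-- The cost `|z| - 1` of a jump by `z`. -/
def jumpCost (z : ℤ) : ℤ := |z| - 1

/-- The total cost of the jump sequence given by `π`. -/
def seqCost {n : ℕ} (π : Equiv.Perm (Fin n)) : ℤ :=
  ∑ i : Fin (n + 1), jumpCost (jumpSeq π i.succ - jumpSeq π i.castSucc)

/-- The word read from `w` along the jump sequence given by `π`. -/
def readWord {α : Type*} (w : List α) (π : Equiv.Perm (Fin w.length)) : List α :=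
  List.ofFn fun i => w.get (π i)

/-- The absolute-distance cost of `w` in `M`: the least cost of a jump sequence along which `M`
accepts `w`, and `⊤` if there is none. Costs of jump sequences are nonnegative (`seqCost_nonneg`),
so that `Int.toNat` loses nothing. -/
noncomputable def absCost {α σ : Type*} (M : NFA α σ) (w : List α) : ℕ∞ :=
  sInf {c : ℕ∞ | ∃ π : Equiv.Perm (Fin w.length),
    readWord w π ∈ M.accepts ∧ c = ((seqCost π).toNat : ℕ∞)}

theorem jumpSeq_injective {n : ℕ} (π : Equiv.Perm (Fin n)) : Function.Injective (jumpSeq π) := by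
  intro i j
  unfold jumpSeq
  refine Fin.cases ?_ (fun i => ?_) i <;> refine Fin.cases ?_ (fun j => ?_) j
  · simp
  · refine Fin.lastCases ?_ (fun j => ?_) j <;> simp <;> intro h <;> omega
  · refine Fin.lastCases ?_ (fun i => ?_) i <;> simp <;> intro h <;> omega
  · refine Fin.lastCases ?_ (fun i => ?_) i <;> refine Fin.lastCases ?_ (fun j => ?_) j
    · simp
    · have := (π j).isLt
      simp; omega
    · have := (π i).isLt
      simp; omega
    · simp [Fin.val_inj]

theorem seqCost_nonneg {n : ℕ} (π : Equiv.Perm (Fin n)) : 0 ≤ seqCost π := by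
  refine Finset.sum_nonneg fun i _ => ?_
  have h : jumpSeq π i.succ ≠ jumpSeq π i.castSucc := fun h =>
    (Fin.castSucc_lt_succ (i := i)).ne' (jumpSeq_injective π h)
  have := abs_pos.2 (sub_ne_zero.2 h)
  unfold jumpCost
  omega

/-- A finite presentation of an NFA, as given to an algorithm: the alphabet is `Fin letters`, the
state set is `Fin states`, and the transitions `(q, a, q')`, the initial states and the accepting
states are listed. Entries out of range are void. -/
structure FinNFA where
  letters : ℕ
  states : ℕ
  transitions : List (ℕ × ℕ × ℕ)
  initial : List ℕ
  accepting : List ℕ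

namespace FinNFA

/-- The NFA that is presented. -/
def toNFA (A : FinNFA) : NFA (Fin A.letters) (Fin A.states) where
  step q a := {q' | ((q : ℕ), (a : ℕ), (q' : ℕ)) ∈ A.transitions}
  start := {q | (q : ℕ) ∈ A.initial}
  accept := {q | (q : ℕ) ∈ A.accepting}

/-- Every NFA over `Fin m` with states `Fin n` has a presentation. -/
theorem exists_toNFA_eq {m n : ℕ} (M : NFA (Fin m) (Fin n)) :
    ∃ t i f, (FinNFA.mk m n t i f).toNFA = M := by
  classical
  refine ⟨((Finset.univ : Finset (Fin n × Fin m × Fin n)).toList.filter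
      fun x => x.2.2 ∈ M.step x.1 x.2.1).map fun x => ((x.1 : ℕ), (x.2.1 : ℕ), (x.2.2 : ℕ)),
    ((Finset.univ : Finset (Fin n)).toList.filter fun q => q ∈ M.start).map fun q => (q : ℕ),
    ((Finset.univ : Finset (Fin n)).toList.filter fun q => q ∈ M.accept).map fun q => (q : ℕ), ?_⟩
  obtain ⟨s, i, f⟩ := M
  simp only [toNFA, NFA.mk.injEq]
  refine ⟨?_, ?_, ?_⟩
  · funext q a
    ext q'
    simp [Fin.val_inj]
  · ext q
    simp [Fin.val_inj]
  · ext q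
    simp [Fin.val_inj]

/-- A presentation is the tuple of its five entries. -/
def equivTuple : FinNFA ≃ ℕ × ℕ × List (ℕ × ℕ × ℕ) × List ℕ × List ℕ where
  toFun A := (A.letters, A.states, A.transitions, A.initial, A.accepting)
  invFun x := ⟨x.1, x.2.1, x.2.2.1, x.2.2.2.1, x.2.2.2.2⟩
  left_inv _ := rfl
  right_inv _ := rfl

instance : Primcodable FinNFA := Primcodable.ofEquiv _ equivTuple

/-- All words of the jumping language have absolute-distance cost at most `k`. -/
def AbsBounded (A : FinNFA) (k : ℕ) : Prop :=
  ∀ w ∈ jumpingLanguage A.toNFA, absCost A.toNFA w ≤ k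

/-- All words over the alphabet have absolute-distance cost at most `k`. -/
def UnivAbsBounded (A : FinNFA) (k : ℕ) : Prop :=
  ∀ w : List (Fin A.letters), absCost A.toNFA w ≤ k

end FinNFA

/-! Everything rests on an effective bound: for an NFA with `n` states, the words of cost at most
`k` are recognised by a DFA with at most `costBound n k` states (`hasDFA_costLe`).

Cut a word as `u ++ v` and close the walk of a jump sequence by a return from the right end marker
to the left one. Cost at most `k` means that the closed walk has length at most `2|u| + 2|v| + 2 +
k`. Its crossings of the cut split it into rounds, each a block in `u` followed by a block in `v`
(`costLe_append_iff`). Closed up at the cut, a block becomes a tour at least twice as long as its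
farthest distance, so the tours add up to at least `2|u|` on the left and `2|v|` on the right, and
every round adds 2 for its crossings. Hence there are at most `k + 1` rounds, and the left tours
exceed `2|u|` by at most `k`. All that matters about `u` is which lists of block actions on state
sets occur with which excess. There are finitely many such profiles, and Myhill–Nerode applies.

Universal boundedness then fails only if it fails on a short word. Boundedness on the jumping
language fails when an accepted word is a permutation of a word of cost above `k`. Such a pair can
be taken short (`exists_perm_of_perm`): reduce both runs to short bases that visit the same states,
plus short loops; the differences of letter counts form a zero-sum list of bounded vectors, of which
a short zero-sum part containing the bases is kept.

So all the decision problems are bounded searches. The NFA is found by an unbounded search: a test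
on finitely many words certifies a candidate, and regularity makes the search stop. -/

/-! ### Costs as lengths of walks -/

/-- The length of the walk on the integers that starts at `x` and visits the entries of a list. -/
def pathDist (x : ℤ) : List ℤ → ℕ
  | [] => 0
  | y :: l => (y - x).natAbs + pathDist y l

/-- Some jump sequence of cost at most `k` reads from `w` a word of `L`. The jump sequence is
given by its list of positions, counted from `0`. -/
def CostLe {α : Type*} (L : Language α) (k : ℕ) (w : List α) : Prop :=
  ∃ p : List ℕ, p.Perm (List.range w.length) ∧ p.filterMap (w[·]?) ∈ L ∧
    pathDist 0 (p.map (fun i : ℕ => (i : ℤ) + 1) ++ [(w.length : ℤ) + 1]) ≤ k + w.length + 1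

theorem pathDist_ofFn {n : ℕ} (f : Fin (n + 1) → ℤ) :
    (pathDist (f 0) (List.ofFn fun i : Fin n => f i.succ) : ℤ) =
      ∑ i : Fin n, |f i.succ - f i.castSucc| := by
  induction n with
  | zero => simp [pathDist]
  | succ n ih =>
    rw [List.ofFn_succ, pathDist, Fin.sum_univ_succ]
    have := ih fun i => f i.succ
    push_cast
    rw [this]
    simp

theorem ofFn_jumpSeq {n : ℕ} (π : Equiv.Perm (Fin n)) :
    (List.ofFn fun i : Fin (n + 1) => jumpSeq π i.succ) =
      (List.ofFn fun i => (π i : ℕ)).map (fun i : ℕ => (i : ℤ) + 1) ++ [(n : ℤ) + 1] := by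
  rw [List.ofFn_succ', List.concat_eq_append]
  simp only [jumpSeq, List.map_ofFn, Function.comp_def, Fin.cons_succ, Fin.snoc_castSucc,
    Fin.snoc_last]

/-- Each of the `n + 1` jumps is charged one less than its distance. -/
theorem seqCost_eq_pathDist {n : ℕ} (π : Equiv.Perm (Fin n)) :
    seqCost π = pathDist 0 ((List.ofFn fun i => (π i : ℕ)).map (fun i : ℕ => (i : ℤ) + 1) ++
      [(n : ℤ) + 1]) - (n + 1) := by
  have h := pathDist_ofFn (jumpSeq π)
  rw [ofFn_jumpSeq] at h
  have h0 : jumpSeq π 0 = 0 := by simp [jumpSeq]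
  rw [h0] at h
  rw [h]
  simp [seqCost, jumpCost, Finset.sum_sub_distrib]

theorem readWord_eq_filterMap {α : Type*} (w : List α) (π : Equiv.Perm (Fin w.length)) :
    readWord w π = (List.ofFn fun i => (π i : ℕ)).filterMap (w[·]?) := by
  rw [List.ofFn_eq_map, List.filterMap_map, readWord, List.ofFn_eq_map, ← List.filterMap_eq_map]
  exact List.filterMap_congr fun i _ => by simp

theorem exists_perm_ofFn {n : ℕ} {p : List ℕ} (h : p.Perm (List.range n)) :
    ∃ π : Equiv.Perm (Fin n), (List.ofFn fun i => (π i : ℕ)) = p := by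
  have hl : p.length = n := by simpa using h.length_eq
  have hlt : ∀ i : Fin n, p[(i : ℕ)]'(by omega) < n := fun i =>
    List.mem_range.1 (h.mem_iff.1 (List.getElem_mem _))
  have hinj : Function.Injective fun i : Fin n => (⟨p[(i : ℕ)]'(by omega), hlt i⟩ : Fin n) := by
    intro i j hij
    have hnd : p.Nodup := h.nodup_iff.2 List.nodup_range
    exact Fin.ext ((hnd.getElem_inj_iff).1 (Fin.mk.inj hij))
  refine ⟨Equiv.ofBijective _ (Finite.injective_iff_bijective.1 hinj), ?_⟩
  apply List.ext_getElem <;> simp [hl]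

theorem ofFn_perm_range {n : ℕ} (π : Equiv.Perm (Fin n)) :
    (List.ofFn fun i => (π i : ℕ)).Perm (List.range n) := by
  refine (List.perm_ext_iff_of_nodup ?_ List.nodup_range).2 fun a => ?_
  · exact List.nodup_ofFn.2 fun i j h => π.injective (Fin.ext h)
  · simp only [List.mem_ofFn, List.mem_range]
    exact ⟨fun ⟨i, hi⟩ => hi ▸ (π i).isLt, fun h => ⟨π.symm ⟨a, h⟩, by simp⟩⟩

theorem absCost_le_iff {α σ : Type*} (M : NFA α σ) (w : List α) (k : ℕ) :
    absCost M w ≤ k ↔ CostLe M.accepts k w := by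
  have key : absCost M w ≤ k ↔ ∃ π : Equiv.Perm (Fin w.length),
      readWord w π ∈ M.accepts ∧ (seqCost π).toNat ≤ k := by
    constructor
    · intro h
      -- The infimum of the empty set is `⊤`, which is not at most `k`; a nonempty set of `ℕ∞`
      -- attains its infimum.
      have hne : {c : ℕ∞ | ∃ π : Equiv.Perm (Fin w.length),
          readWord w π ∈ M.accepts ∧ c = ((seqCost π).toNat : ℕ∞)}.Nonempty := by
        by_contra hne
        rw [Set.not_nonempty_iff_eq_empty] at hne
        rw [absCost, hne, sInf_empty] at h
        exact absurd h (by simp)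
      obtain ⟨π, hπ, hc⟩ := csInf_mem hne
      refine ⟨π, hπ, ?_⟩
      rw [absCost, hc] at h
      exact_mod_cast h
    · rintro ⟨π, hπ, hc⟩
      exact sInf_le_of_le ⟨π, hπ, rfl⟩ (by exact_mod_cast hc)
  rw [key]
  constructor
  · rintro ⟨π, hπ, hc⟩
    refine ⟨_, ofFn_perm_range π, readWord_eq_filterMap w π ▸ hπ, ?_⟩
    rw [seqCost_eq_pathDist] at hc
    omega
  · rintro ⟨p, hp, hacc, hc⟩
    obtain ⟨π, rfl⟩ := exists_perm_ofFn hp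
    refine ⟨π, readWord_eq_filterMap w π ▸ hacc, ?_⟩
    rw [seqCost_eq_pathDist]
    omega

theorem filterMap_getElem?_range {α : Type*} (w : List α) :
    (List.range w.length).filterMap (w[·]?) = w := by
  induction w with
  | nil => rfl
  | cons a w ih =>
    rw [List.length_cons, List.range_succ_eq_map, List.filterMap_cons]
    simpa [List.filterMap_map, Function.comp_def] using ih

theorem exists_filterMap_getElem?_eq {α : Type*} {u w : List α} (h : u.Perm w) :
    ∃ p : List ℕ, p.Perm (List.range w.length) ∧ p.filterMap (w[·]?) = u := by
  have hr : List.Forall₂ (fun a i => w[i]? = some a) w (List.range w.length) := by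
    rw [List.forall₂_iff_get]
    simp
  obtain ⟨q, hq, hp⟩ := List.perm_comp_forall₂ h hr
  refine ⟨q, hp, ?_⟩
  clear hp hr h
  induction hq with
  | nil => rfl
  | cons h _ ih => rw [List.filterMap_cons_some h, ih]

theorem mem_jumpingLanguage_iff {α σ : Type*} (M : NFA α σ) (w : List α) :
    w ∈ jumpingLanguage M ↔ ∃ p : List ℕ, p.Perm (List.range w.length) ∧
      p.filterMap (w[·]?) ∈ M.accepts := by
  constructor
  · rintro ⟨u, hu, hacc⟩
    obtain ⟨p, hp, rfl⟩ := exists_filterMap_getElem?_eq hu.symm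
    exact ⟨p, hp, hacc⟩
  · rintro ⟨p, hp, hacc⟩
    refine ⟨_, ?_, hacc⟩
    have := (hp.filterMap (w[·]?)).symm
    rwa [filterMap_getElem?_range] at this

/-! ### Cutting a walk into blocks -/

theorem pathDist_append_cons (x y : ℤ) (l l' : List ℤ) :
    pathDist x (l ++ y :: l') = pathDist x (l ++ [y]) + pathDist y l' := by
  induction l generalizing x with
  | nil => simp [pathDist]
  | cons z l ih => simp [pathDist, ih z, add_assoc]

theorem natAbs_le_pathDist (x y : ℤ) (l : List ℤ) : (y - x).natAbs ≤ pathDist x (l ++ [y]) := by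
  induction l generalizing x with
  | nil => simp [pathDist]
  | cons z l ih =>
    have := ih z
    simp only [List.cons_append, pathDist]
    omega

theorem pathDist_map_add (x c : ℤ) (l : List ℤ) :
    pathDist (x + c) (l.map (· + c)) = pathDist x l := by
  induction l generalizing x with
  | nil => rfl
  | cons z l ih => simp [pathDist, ih z]

/-- The length of the closed walk from `0` through the entries of a list. -/
def tour (B : List ℕ) : ℕ := pathDist 0 (B.map Int.ofNat ++ [0])

/-- The closed walk has to go out to `a` and come back. -/
theorem two_mul_le_tour {B : List ℕ} {a : ℕ} (h : a ∈ B) : 2 * a ≤ tour B := by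
  obtain ⟨s, t, rfl⟩ := List.append_of_mem h
  have h1 := natAbs_le_pathDist 0 a (s.map Int.ofNat)
  have h2 := natAbs_le_pathDist a 0 (t.map Int.ofNat)
  have h3 := pathDist_append_cons 0 a (s.map Int.ofNat) (t.map Int.ofNat ++ [0])
  simp only [tour, List.map_append, List.map_cons, List.append_assoc, List.cons_append]
  simp only [Int.ofNat_eq_natCast] at *
  omega

/-- The walk on the integers that alternates between blocks on the negative side and blocks on the
nonnegative side. A block is given by the distances from the cut between `-1` and `0`. -/
def interleave (R : List (List ℕ × List ℕ)) : List ℤ :=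
  R.flatMap fun r => r.1.map Int.negSucc ++ r.2.map Int.ofNat

theorem interleave_cons (r : List ℕ × List ℕ) (R : List (List ℕ × List ℕ)) :
    interleave (r :: R) = r.1.map Int.negSucc ++ r.2.map Int.ofNat ++ interleave R := by
  simp [interleave]

/-- Reflection turns the negative side into distances from `-1`. Leaving it for `z` passes through
`-1`, then crosses the cut by one unit, then goes on from `0`. -/
theorem pathDist_negSucc (a z : ℕ) (P : List ℕ) :
    pathDist (Int.negSucc a) (P.map Int.negSucc ++ [(z : ℤ)]) =
      pathDist a (P.map Int.ofNat ++ [0]) + 1 + z := by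
  induction P generalizing a with
  | nil => simp [pathDist]; omega
  | cons b P ih =>
    simp only [List.map_cons, List.cons_append, pathDist, ih b]
    simp only [Int.ofNat_eq_natCast]
    omega

/-- Every crossing passes through `-1` and `0`. Splitting the walk there closes each block into a
tour; the 2 in each round counts its two crossings. -/
theorem pathDist_interleave (y : ℕ) (R : List (List ℕ × List ℕ))
    (hR : ∀ r ∈ R, r.1 ≠ [] ∧ r.2 ≠ []) :
    pathDist y (interleave R ++ [0]) = y + (R.map fun r => tour r.1 + tour r.2 + 2).sum := by
  induction R generalizing y with
  | nil => simp [interleave, pathDist]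
  | cons r R ih =>
    obtain ⟨P, S⟩ := r
    have hPS := hR _ List.mem_cons_self
    obtain ⟨a, P, rfl⟩ := List.exists_cons_of_ne_nil hPS.1
    obtain ⟨s, S, rfl⟩ := List.exists_cons_of_ne_nil hPS.2
    have key : ∀ (s : ℕ) (S : List ℕ), pathDist s (S.map Int.ofNat ++ (interleave R ++ [0])) =
        pathDist s (S.map Int.ofNat ++ [0]) + (R.map fun r => tour r.1 + tour r.2 + 2).sum := by
      intro s S
      induction S generalizing s with
      | nil =>
        simp only [List.map_nil, List.nil_append]
        rw [ih s fun r hr => hR r (List.mem_cons_of_mem _ hr)]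
        simp [pathDist]
      | cons b S ihS =>
        simp only [List.map_cons, List.cons_append, pathDist, Int.ofNat_eq_natCast] at ihS ⊢
        rw [ihS b, add_assoc]
    simp only [interleave_cons, List.map_cons, List.cons_append, List.append_assoc, pathDist,
      List.sum_cons, tour, Int.ofNat_eq_natCast]
    have := pathDist_append_cons (Int.negSucc a) s (P.map Int.negSucc)
      (S.map Int.ofNat ++ (interleave R ++ [0]))
    have h2 := pathDist_negSucc a s P
    rw [this, key, h2]
    simp only [tour]
    omega

theorem exists_eq_append_interleave (l : List ℤ) (z : ℕ) :
    ∃ (S : List ℕ) (R : List (List ℕ × List ℕ)), l ++ [(z : ℤ)] = S.map Int.ofNat ++ interleave R ∧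
      ∀ r ∈ R, r.1 ≠ [] ∧ r.2 ≠ [] := by
  induction l with
  | nil => exact ⟨[z], [], by simp [interleave], by simp⟩
  | cons x l ih =>
    obtain ⟨S, R, h, hR⟩ := ih
    rw [List.cons_append, h]
    cases x with
    | ofNat x => exact ⟨x :: S, R, by simp, hR⟩
    | negSucc x =>
      cases S with
      | cons s S =>
        exact ⟨[], ([x], s :: S) :: R, by simp [interleave_cons],
          List.forall_mem_cons.2 ⟨by simp, hR⟩⟩
      | nil =>
        cases R with
        | nil => simp [interleave] at h
        | cons r R =>
          rw [List.forall_mem_cons] at hR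
          exact ⟨[], (x :: r.1, r.2) :: R, by simp [interleave_cons],
            List.forall_mem_cons.2 ⟨⟨by simp, hR.1.2⟩, hR.2⟩⟩

theorem interleave_perm (R : List (List ℕ × List ℕ)) :
    (interleave R).Perm ((R.map Prod.fst).flatten.map Int.negSucc ++
      (R.map Prod.snd).flatten.map Int.ofNat) := by
  induction R with
  | nil => simp [interleave]
  | cons r R ih =>
    simp only [interleave_cons, List.map_cons, List.flatten_cons, List.map_append]
    refine (ih.append_left _).trans ?_
    simp only [List.append_assoc]
    refine List.Perm.append_left _ ?_
    rw [← List.append_assoc, ← List.append_assoc]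
    exact List.perm_append_comm.append_right _

theorem getLast?_interleave (R : List (List ℕ × List ℕ)) (hR : ∀ r ∈ R, r.1 ≠ [] ∧ r.2 ≠ []) :
    (interleave R).getLast? = (R.map Prod.snd).flatten.getLast?.map Int.ofNat := by
  induction R with
  | nil => simp [interleave]
  | cons r R ih =>
    rw [List.forall_mem_cons] at hR
    rw [interleave_cons, List.getLast?_append, ih hR.2, List.getLast?_append, List.map_cons,
      List.flatten_cons, List.getLast?_append, List.getLast?_map]
    obtain ⟨⟨-, h⟩, -⟩ := hR
    rw [List.getLast?_eq_some_getLast h]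
    cases ((R.map Prod.snd).flatten.getLast?) <;> simp

/-- The letter of `u ++ v` at a position counted from the cut between `u` and `v`. -/
def cutLetter {α : Type*} (u v : List α) : ℤ → Option α
  | Int.ofNat y => v[y]?
  | Int.negSucc x => u.reverse[x]?

theorem cutLetter_sub_length {α : Type*} (u v : List α) (i : ℕ) :
    cutLetter u v ((i : ℤ) - u.length) = (u ++ v)[i]? := by
  rcases lt_or_ge i u.length with h | h
  · have : (i : ℤ) - u.length = Int.negSucc (u.length - 1 - i) := by omega
    rw [this, cutLetter, List.getElem?_reverse (by omega), List.getElem?_append_left h]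
    congr 1; omega
  · have : (i : ℤ) - u.length = Int.ofNat (i - u.length) := by
      rw [Int.ofNat_eq_natCast]; omega
    rw [this, cutLetter, List.getElem?_append_right h]

theorem filterMap_interleave {α : Type*} (u v : List α) (R : List (List ℕ × List ℕ)) :
    (interleave R).filterMap (cutLetter u v) =
      R.flatMap fun r => r.1.filterMap (u.reverse[·]?) ++ r.2.filterMap (v[·]?) := by
  induction R with
  | nil => simp [interleave]
  | cons r R ih =>
    simp [interleave_cons, ih, List.filterMap_map, Function.comp_def, cutLetter]

/-- A jump sequence through `u ++ v`, with positions counted from the cut. -/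
def cutSeq (m n : ℕ) (p : List ℕ) : List ℤ :=
  Int.negSucc m :: (p.map (fun i : ℕ => (i : ℤ) - m) ++ [(n : ℤ)])

theorem filterMap_cutSeq {α : Type*} (u v : List α) (p : List ℕ) :
    (cutSeq u.length v.length p).filterMap (cutLetter u v) = p.filterMap ((u ++ v)[·]?) := by
  have h1 : cutLetter u v (Int.negSucc u.length) = none := by simp [cutLetter]
  have h2 : cutLetter u v v.length = none := by
    rw [← Int.ofNat_eq_natCast, cutLetter]; simp
  rw [cutSeq, List.filterMap_cons_none h1, List.filterMap_append, List.filterMap_map]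
  simp only [Function.comp_def, cutLetter_sub_length]
  simp [h2]

/-- The way from the cut to the left marker and back from the right marker has length `(m + 1) + n`.
-/
theorem pathDist_cutSeq (m n : ℕ) (p : List ℕ) :
    pathDist 0 (cutSeq m n p ++ [0]) = m + n + 1 +
      pathDist 0 (p.map (fun i : ℕ => (i : ℤ) + 1) ++ [((m + n : ℕ) : ℤ) + 1]) := by
  have h := pathDist_map_add 0 (-(m : ℤ) - 1)
    (p.map (fun i : ℕ => (i : ℤ) + 1) ++ [((m + n : ℕ) : ℤ) + 1])
  have h1 := pathDist_append_cons (Int.negSucc m) n (p.map (fun i : ℕ => (i : ℤ) - m)) [0]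
  have e : (p.map (fun i : ℕ => (i : ℤ) + 1) ++ [((m + n : ℕ) : ℤ) + 1]).map
      (· + (-(m : ℤ) - 1)) = p.map (fun i : ℕ => (i : ℤ) - m) ++ [(n : ℤ)] := by
    simp only [List.map_append, List.map_map, List.map_cons, List.map_nil]
    congr 1
    · exact List.map_congr_left fun i _ => by simp only [Function.comp]; ring
    · push_cast; congr 1; ring
  have e2 : (0 : ℤ) + (-(m : ℤ) - 1) = Int.negSucc m := by omega
  rw [e, e2] at h
  simp only [cutSeq, List.cons_append, List.append_assoc, pathDist, List.nil_append]
  rw [h1, h]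
  simp [pathDist]
  omega

theorem cutSeq_range_perm (m n : ℕ) : (cutSeq m n (List.range (m + n))).Perm
    ((List.range (m + 1)).map Int.negSucc ++ (List.range (n + 1)).map Int.ofNat) := by
  have inj : Function.Injective fun i : ℕ => (i : ℤ) - m := fun i j h => by
    simpa using h
  refine (List.perm_ext_iff_of_nodup ?_ ?_).2 fun a => ?_
  · rw [cutSeq, List.nodup_cons, List.nodup_append]
    refine ⟨?_, List.nodup_range.map inj, by simp, ?_⟩
    · simp only [List.mem_append, List.mem_map, List.mem_range, List.mem_singleton]
      omega
    · simp only [List.mem_map, List.mem_range, List.mem_singleton]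
      omega
  · rw [List.nodup_append]
    refine ⟨List.nodup_range.map fun i j h => by simpa using h,
      List.nodup_range.map fun i j h => by simpa using h, ?_⟩
    simp only [List.mem_map]
    rintro _ ⟨i, _, rfl⟩ _ ⟨j, _, rfl⟩
    simp
  · simp only [cutSeq, List.mem_cons, List.mem_append, List.mem_map, List.mem_range,
      List.not_mem_nil, or_false]
    constructor
    · rintro (rfl | ⟨i, hi, rfl⟩ | rfl)
      · exact Or.inl ⟨m, by omega, rfl⟩
      · rcases lt_or_ge i m with h | h
        · exact Or.inl ⟨m - 1 - i, by omega, by omega⟩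
        · exact Or.inr ⟨i - m, by omega, by rw [Int.ofNat_eq_natCast]; omega⟩
      · exact Or.inr ⟨n, by omega, rfl⟩
    · rintro (⟨i, hi, rfl⟩ | ⟨i, hi, rfl⟩)
      · rcases Nat.lt_succ_iff_lt_or_eq.1 hi with h | rfl
        · exact Or.inr (Or.inl ⟨m - 1 - i, by omega, by omega⟩)
        · exact Or.inl rfl
      · rcases Nat.lt_succ_iff_lt_or_eq.1 hi with h | rfl
        · exact Or.inr (Or.inl ⟨m + i, by omega, by rw [Int.ofNat_eq_natCast]; omega⟩)
        · exact Or.inr (Or.inr rfl)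

theorem cutSeq_perm_cutSeq {m n : ℕ} {p q : List ℕ} :
    (cutSeq m n p).Perm (cutSeq m n q) ↔ p.Perm q := by
  rw [cutSeq, cutSeq, List.perm_cons, List.perm_append_right_iff]
  exact List.map_perm_map_iff fun i j h => by simpa using h

/-- The blocks, given by the distances from the right end of `u`, of a jump sequence in `u`. -/
def IsPrefixBlocks (m : ℕ) (P : List (List ℕ)) : Prop :=
  P.flatten.Perm (List.range (m + 1)) ∧ P.flatten.head? = some m ∧ ∀ B ∈ P, B ≠ []

/-- The blocks, given by the distances from the left end of `v`, of a jump sequence in `v`. -/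
def IsSuffixBlocks (n : ℕ) (S : List (List ℕ)) : Prop :=
  S.flatten.Perm (List.range (n + 1)) ∧ S.flatten.getLast? = some n ∧ ∀ B ∈ S, B ≠ []

/-- The walk between the end markers is closed through the cut and split at its crossings. The
markers lie in the first left and the last right block, at distances `u.length` and `v.length`,
where there is no letter to read. -/
theorem costLe_append_iff {α : Type*} (L : Language α) (k : ℕ) (u v : List α) :
    CostLe L k (u ++ v) ↔ ∃ R : List (List ℕ × List ℕ),
      IsPrefixBlocks u.length (R.map Prod.fst) ∧ IsSuffixBlocks v.length (R.map Prod.snd) ∧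
      (R.flatMap fun r => r.1.filterMap (u.reverse[·]?) ++ r.2.filterMap (v[·]?)) ∈ L ∧
      (R.map fun r => tour r.1 + tour r.2 + 2).sum ≤ k + 2 + 2 * u.length + 2 * v.length := by
  have key : ∀ (p : List ℕ) (R : List (List ℕ × List ℕ)), (∀ r ∈ R, r.1 ≠ [] ∧ r.2 ≠ []) →
      cutSeq u.length v.length p = interleave R →
      ((p.filterMap ((u ++ v)[·]?) ∈ L ∧
        pathDist 0 (p.map (fun i : ℕ => (i : ℤ) + 1) ++ [((u ++ v).length : ℤ) + 1]) ≤
          k + (u ++ v).length + 1) ↔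
      ((R.flatMap fun r => r.1.filterMap (u.reverse[·]?) ++ r.2.filterMap (v[·]?)) ∈ L ∧
      (R.map fun r => tour r.1 + tour r.2 + 2).sum ≤ k + 2 + 2 * u.length + 2 * v.length)) := by
    intro p R hR h
    rw [← filterMap_cutSeq, h, filterMap_interleave]
    have h1 := pathDist_cutSeq u.length v.length p
    have h2 := pathDist_interleave 0 R hR
    rw [h] at h1
    rw [List.length_append]
    simp only [Nat.cast_zero] at h2
    rw [h1] at h2
    have : ∀ x y : ℕ, (x ≤ y) = (u.length + v.length + 1 + x ≤ u.length + v.length + 1 + y) := by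
      intro x y; simp
    rw [this, h2]
    refine and_congr_right fun _ => ?_
    omega
  constructor
  · rintro ⟨p, hp, hL, hc⟩
    obtain ⟨S, R, h, hR⟩ := exists_eq_append_interleave
      (Int.negSucc u.length :: p.map (fun i : ℕ => (i : ℤ) - u.length)) v.length
    -- The walk starts at the left marker, hence on the negative side.
    have hS : S = [] := by
      cases S with
      | nil => rfl
      | cons s S => simp at h
    subst hS
    rw [List.map_nil, List.nil_append, List.cons_append] at h
    change cutSeq u.length v.length p = interleave R at h
    have hperm : ((R.map Prod.fst).flatten.map Int.negSucc ++
      (R.map Prod.snd).flatten.map Int.ofNat).Perm ((List.range (u.length + 1)).map Int.negSucc ++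
        (List.range (v.length + 1)).map Int.ofNat) := by
      refine (interleave_perm R).symm.trans ?_
      rw [← h]
      rw [List.length_append] at hp
      exact (cutSeq_perm_cutSeq.2 hp).trans (cutSeq_range_perm _ _)
    refine ⟨R, ⟨?_, ?_, ?_⟩, ⟨?_, ?_, ?_⟩, (key p R hR h).1 ⟨hL, hc⟩⟩
    -- Keeping one side of the cut in the permutation of all positions isolates the blocks of that
    -- side.
    · have := hperm.filterMap fun z => match z with
        | Int.negSucc x => some x
        | Int.ofNat _ => none
      simpa [List.filterMap_append, List.filterMap_map, Function.comp_def] using this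
    · cases R with
      | nil => simp [cutSeq, interleave] at h
      | cons r R =>
        obtain ⟨a, P, hP⟩ := List.exists_cons_of_ne_nil (hR r List.mem_cons_self).1
        rw [interleave_cons, hP] at h
        simp only [cutSeq, List.map_cons, List.cons_append, List.cons.injEq,
          Int.negSucc.injEq] at h
        simp [hP, h.1]
    · simp only [List.mem_map]
      rintro _ ⟨r, hr, rfl⟩
      exact (hR r hr).1
    · have := hperm.filterMap fun z => match z with
        | Int.negSucc x => none
        | Int.ofNat x => some x
      simpa [List.filterMap_append, List.filterMap_map, Function.comp_def] using this
    · have h' := getLast?_interleave R hR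
      rw [← h, cutSeq, ← List.cons_append, List.getLast?_concat] at h'
      cases e : (R.map Prod.snd).flatten.getLast? with
      | none => simp [e] at h'
      | some x => simp [e] at h'; rw [h']
    · simp only [List.mem_map]
      rintro _ ⟨r, hr, rfl⟩
      exact (hR r hr).2
  · rintro ⟨R, ⟨hP, hP0, hPn⟩, ⟨hS, hS0, hSn⟩, hLc⟩
    have hR : ∀ r ∈ R, r.1 ≠ [] ∧ r.2 ≠ [] := fun r hr =>
      ⟨hPn _ (List.mem_map_of_mem hr), hSn _ (List.mem_map_of_mem hr)⟩
    have hperm := ((interleave_perm R).trans ((hP.map _).append (hS.map _))).trans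
      (cutSeq_range_perm _ _).symm
    have hlast := getLast?_interleave R hR
    rw [hS0] at hlast
    cases R with
    | nil => simp at hP0
    | cons r R =>
      obtain ⟨a, P, hrP⟩ := List.exists_cons_of_ne_nil (hR r List.mem_cons_self).1
      simp only [List.map_cons, List.flatten_cons, hrP, List.cons_append, List.head?_cons,
        Option.some.injEq] at hP0
      subst hP0
      obtain ⟨X, hX⟩ : ∃ X, interleave (r :: R) = X ++ [(v.length : ℤ)] :=
        ⟨_, (List.dropLast_append_getLast? _ hlast).symm⟩
      cases X with
      | nil =>
        rw [interleave_cons, hrP] at hX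
        simp at hX
      | cons x X =>
        have hx : x = Int.negSucc u.length := by
          rw [interleave_cons, hrP] at hX
          simp at hX
          exact hX.1.symm
        subst hx
        rw [hX, cutSeq, List.cons_append, List.perm_cons, List.perm_append_right_iff] at hperm
        -- A permutation of an image is the image of a permutation, which gives back the list of
        -- positions.
        have hp : Relation.Comp (· = List.map (fun i : ℕ => (i : ℤ) - u.length) ·) List.Perm X
            (List.range (u.length + v.length)) := by
          rw [List.eq_map_comp_perm]
          exact hperm
        obtain ⟨p, rfl, hp⟩ := hp
        rw [← List.length_append] at hp
        exact ⟨p, hp, (key p (r :: R) hR hX.symm).2 hLc⟩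

/-! ### Regularity by Myhill–Nerode -/

/-- `L` is recognised by a DFA with at most `N` states. -/
def HasDFA {α : Type*} (L : Language α) (N : ℕ) : Prop :=
  ∃ n ≤ N, ∃ M : DFA α (Fin n), M.accepts = L

theorem DFA.hasDFA {α σ : Type*} [Fintype σ] (M : DFA α σ) {N : ℕ} (h : Fintype.card σ ≤ N) :
    HasDFA M.accepts N :=
  ⟨_, h, DFA.reindex (Fintype.equivFin σ) M, DFA.accepts_reindex _ _⟩

/-- The left quotients are the states of the minimal DFA; taking `f` at a representative of each
embeds them into `τ`. -/
theorem hasDFA_of_leftQuotient {α τ : Type*} [Fintype τ] {L : Language α} (f : List α → τ)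
    (hf : ∀ u u', f u = f u' → L.leftQuotient u = L.leftQuotient u') {N : ℕ}
    (h : Fintype.card τ ≤ N) : HasDFA L N := by
  classical
  have hinj : ∃ g : Set.range L.leftQuotient → τ, Function.Injective g := by
    refine ⟨fun x => f x.2.choose, fun x y hxy => Subtype.ext ?_⟩
    rw [← x.2.choose_spec, ← y.2.choose_spec]
    exact hf _ _ hxy
  obtain ⟨g, hg⟩ := hinj
  have : Finite (Set.range L.leftQuotient) := Finite.of_injective g hg
  have := Fintype.ofFinite (Set.range L.leftQuotient)
  have h2 := L.toDFA.hasDFA ((Fintype.card_le_of_injective g hg).trans h)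
  rwa [Language.accepts_toDFA] at h2

namespace NFA

variable {α σ : Type*} (M : NFA α σ)

/-- The action on state sets of the word that a block reads from `w`. -/
def blockAction (w : List α) (B : List ℕ) (T : Set σ) : Set σ :=
  M.evalFrom T (B.filterMap (w[·]?))

/-- The actions and the total tour lengths of the prefix blocks in `u`. -/
def profile (k : ℕ) (u : List α) :
    Set ((Fin (k + 1) → Option (Set σ → Set σ)) × Fin (k + 1)) :=
  {x | ∃ P, IsPrefixBlocks u.length P ∧ P.length ≤ k + 1 ∧
    (∀ i, x.1 i = (P.map (M.blockAction u.reverse))[(i : ℕ)]?) ∧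
    (P.map tour).sum = 2 * u.length + x.2}

/-- Left blocks may be exchanged for blocks with the same actions, the right blocks being kept. -/
theorem evalFrom_flatMap_congr (x x' y : List α) (P' : List (List ℕ))
    (R : List (List ℕ × List ℕ))
    (h : P'.map (M.blockAction x') = (R.map Prod.fst).map (M.blockAction x)) (T : Set σ) :
    M.evalFrom T ((P'.zip (R.map Prod.snd)).flatMap
        fun r => r.1.filterMap (x'[·]?) ++ r.2.filterMap (y[·]?)) =
      M.evalFrom T (R.flatMap fun r => r.1.filterMap (x[·]?) ++ r.2.filterMap (y[·]?)) := by
  induction R generalizing P' T with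
  | nil => simp
  | cons r R ih =>
    cases P' with
    | nil => simp at h
    | cons B P' =>
      simp only [List.map_cons, List.cons.injEq] at h
      have h1 := congrFun h.1 T
      simp only [blockAction] at h1
      simp only [List.map_cons, List.zip_cons_cons, List.flatMap_cons, evalFrom_append, h1]
      exact ih _ h.2 _

theorem sum_tour_eq (R : List (List ℕ × List ℕ)) :
    (R.map fun r => tour r.1 + tour r.2 + 2).sum =
      ((R.map Prod.fst).map tour).sum + ((R.map Prod.snd).map tour).sum + 2 * R.length := by
  induction R with
  | nil => rfl
  | cons r R ih => simp [ih]; ring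

theorem two_mul_le_sum_tour {m : ℕ} {P : List (List ℕ)} (h : m ∈ P.flatten) :
    2 * m ≤ (P.map tour).sum := by
  obtain ⟨B, hB, hm⟩ := List.mem_flatten.1 h
  exact (two_mul_le_tour hm).trans (List.le_sum_of_mem (List.mem_map_of_mem hB))

/-- Left blocks in `u'` with the same actions and the same excess replace those in `u`, round by
round. -/
theorem costLe_append_of_profile_eq {k : ℕ} {u u' : List α} (h : M.profile k u = M.profile k u')
    {v : List α} (hc : CostLe M.accepts k (u ++ v)) : CostLe M.accepts k (u' ++ v) := by
  rw [costLe_append_iff] at hc ⊢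
  obtain ⟨R, hP, hS, hacc, hc⟩ := hc
  rw [sum_tour_eq] at hc
  -- Twice the number of rounds plus the left excess is at most `k + 2`. As there is at least one
  -- round, the excess is at most `k`, and there are at most `k + 1` rounds.
  have h1 := two_mul_le_sum_tour (List.mem_of_mem_head? hP.2.1)
  have h2 := two_mul_le_sum_tour (List.mem_of_mem_getLast? hS.2.1)
  have h3 : R.length ≠ 0 := by
    intro h
    simp [List.length_eq_zero_iff.1 h, IsPrefixBlocks] at hP
  let x : (Fin (k + 1) → Option (Set σ → Set σ)) × Fin (k + 1) :=
    (fun i => ((R.map Prod.fst).map (M.blockAction u.reverse))[(i : ℕ)]?,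
      ⟨((R.map Prod.fst).map tour).sum - 2 * u.length, by omega⟩)
  have hx : x ∈ M.profile k u :=
    ⟨_, hP, by rw [List.length_map]; omega, fun _ => rfl, by simp only [x]; omega⟩
  rw [h] at hx
  obtain ⟨P', hP', hlen, heq, hsum⟩ := hx
  have hmap : P'.map (M.blockAction u'.reverse) =
      (R.map Prod.fst).map (M.blockAction u.reverse) := by
    apply List.ext_getElem?
    intro i
    rcases lt_or_ge i (k + 1) with hi | hi
    · exact (heq ⟨i, hi⟩).symm
    · rw [List.getElem?_eq_none, List.getElem?_eq_none]
      · simp only [List.length_map]; omega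
      · rw [List.length_map]; omega
  have hl : P'.length = R.length := by simpa using congrArg List.length hmap
  have hfst : (P'.zip (R.map Prod.snd)).map Prod.fst = P' := List.map_fst_zip (by simp [hl])
  have hsnd : (P'.zip (R.map Prod.snd)).map Prod.snd = R.map Prod.snd :=
    List.map_snd_zip (by simp [hl])
  refine ⟨P'.zip (R.map Prod.snd), by rwa [hfst], by rwa [hsnd], ?_, ?_⟩
  · rw [mem_accepts, M.evalFrom_flatMap_congr u.reverse u'.reverse v P' R hmap]
    exact hacc
  · rw [sum_tour_eq, hfst, hsnd, hsum, List.length_zip, hl]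
    simp only [x, List.length_map, min_self]
    omega

end NFA

/-- A bound for the number of states of a DFA for the words of cost at most `k`. -/
def costBound (n k : ℕ) : ℕ := 2 ^ (((2 ^ n) ^ (2 ^ n) + 1) ^ (k + 1) * (k + 1))

/-- `costBound` counts the possible profiles: the sets of pairs of `k + 1` optional maps on the `2 ^
n` state sets and an excess below `k + 1`. -/
theorem hasDFA_costLe {α : Type*} {n : ℕ} (M : NFA α (Fin n)) (k : ℕ) :
    HasDFA {w | CostLe M.accepts k w} (costBound n k) := by
  classical
  refine hasDFA_of_leftQuotient (M.profile k) (fun u u' h => ?_) ?_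
  · ext v
    exact ⟨M.costLe_append_of_profile_eq h, M.costLe_append_of_profile_eq h.symm⟩
  · simp [costBound]

/-! ### Splitting zero-sum lists of bounded vectors -/

/-- Greedy choice: after a positive partial sum take a negative term, otherwise a nonnegative one.
The total 0 guarantees that one is left. -/
theorem exists_perm_abs_sum_take_le {ι : Type*} (g : ι → ℤ) (C : ℤ) (X : List ι) (s : ℤ)
    (hs : |s| ≤ C) (hX : ∀ x ∈ X, |g x| ≤ C) (h0 : s + (X.map g).sum = 0) :
    ∃ X' : List ι, X.Perm X' ∧ ∀ i, |s + ((X'.take i).map g).sum| ≤ C := by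
  classical
  induction hn : X.length generalizing X s with
  | zero =>
    obtain rfl := List.length_eq_zero_iff.1 hn
    exact ⟨[], List.Perm.refl _, by simpa using hs⟩
  | succ n ih =>
    have : ∃ x ∈ X, |s + g x| ≤ C := by
      rcases lt_or_ge 0 s with h | h
      · obtain ⟨x, hx, hg⟩ : ∃ x ∈ X, g x < 0 := by
          by_contra! hcon
          have : 0 ≤ (X.map g).sum := List.sum_nonneg (by simpa using hcon)
          omega
        refine ⟨x, hx, ?_⟩
        have := hX x hx
        rw [abs_le] at *
        omega
      · obtain ⟨x, hx, hg⟩ : ∃ x ∈ X, 0 ≤ g x := by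
          by_contra! hcon
          have hne : X ≠ [] := by rintro rfl; simp at hn
          have : (X.map g).sum < (X.map fun _ => (0 : ℤ)).sum :=
            List.sum_lt_sum_of_ne_nil hne _ _ hcon
          simp at this
          omega
        refine ⟨x, hx, ?_⟩
        have := hX x hx
        rw [abs_le] at *
        omega
    obtain ⟨x, hx, hsx⟩ := this
    have hp := List.perm_cons_erase hx
    have hsum : (X.map g).sum = g x + ((X.erase x).map g).sum := by
      rw [(hp.map g).sum_eq]; simp
    obtain ⟨X', hX', hb⟩ := ih (X.erase x) (s + g x) hsx
      (fun y hy => hX y (List.mem_of_mem_erase hy)) (by rw [hsum] at h0; linarith)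
      (by rw [List.length_erase_of_mem hx, hn]; rfl)
    refine ⟨x :: X', hp.trans (hX'.cons x), fun i => ?_⟩
    cases i with
    | zero => simpa using hs
    | succ i => simpa [add_assoc] using hb i

theorem exists_zero_sum_blocks_single {ι : Type*} (g : ι → ℤ) (C : ℕ) (X : List ι)
    (hX : ∀ x ∈ X, |g x| ≤ C) (h0 : (X.map g).sum = 0) :
    ∃ Y : List (List ι), X.Perm Y.flatten ∧
      ∀ y ∈ Y, y.length ≤ 2 * C + 1 ∧ (y.map g).sum = 0 := by
  induction hn : X.length using Nat.strong_induction_on generalizing X with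
  | _ n ih =>
    rcases le_or_gt X.length (2 * C + 1) with hl | hl
    · exact ⟨[X], by simp, by simp [hl, h0]⟩
    obtain ⟨X', hp, hb⟩ := exists_perm_abs_sum_take_le g C X 0 (by simp) hX (by simpa using h0)
    -- Pigeonhole: `2 * C + 2` partial sums take at most `2 * C + 1` values. The segment between two
    -- equal ones is a zero-sum block to split off.
    obtain ⟨i, hi, j, hj, hij, heq⟩ : ∃ i ∈ Finset.range (2 * C + 2),
        ∃ j ∈ Finset.range (2 * C + 2), i ≠ j ∧
          ((X'.take i).map g).sum = ((X'.take j).map g).sum := by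
      refine Finset.exists_ne_map_eq_of_card_lt_of_maps_to
        (t := Finset.Icc (-(C : ℤ)) C) ?_ ?_
      · rw [Int.card_Icc, Finset.card_range]; omega
      · intro i _
        have := hb i
        rw [zero_add, abs_le] at this
        exact Finset.mem_Icc.2 this
    wlog hlt : i < j generalizing i j
    · exact this j hj i hi hij.symm heq.symm (by omega)
    rw [Finset.mem_range] at hi hj
    have hlen : X'.length = n := by rw [← hn, hp.length_eq]
    have e1 : X'.take j = X'.take i ++ (X'.take j).drop i := by
      conv_lhs => rw [← List.take_append_drop i (X'.take j), List.take_take, min_eq_left hlt.le]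
    have hblock : (((X'.take j).drop i).map g).sum = 0 := by
      have := congrArg (fun l => (l.map g).sum) e1
      simp only [List.map_append, List.sum_append] at this
      omega
    have hX'p : X'.Perm ((X'.take j).drop i ++ (X'.take i ++ X'.drop j)) := by
      conv_lhs => rw [← List.take_append_drop j X', e1]
      rw [← List.append_assoc]
      exact List.perm_append_comm.append_right _
    have hsum := (((hp.trans hX'p).map g)).sum_eq
    rw [h0, List.map_append, List.sum_append, hblock, zero_add] at hsum
    obtain ⟨Y, hY, hYb⟩ := ih (X'.take i ++ X'.drop j).length
      (by simp only [List.length_append, List.length_take, List.length_drop]; omega)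
      (X'.take i ++ X'.drop j)
      (fun x hx => hX x ((hp.trans hX'p).mem_iff.2 (List.mem_append_right _ hx)))
      hsum.symm rfl
    refine ⟨(X'.take j).drop i :: Y, ?_, List.forall_mem_cons.2 ⟨⟨?_, hblock⟩, hYb⟩⟩
    · exact (hp.trans hX'p).trans (hY.append_left _)
    · simp only [List.length_drop, List.length_take]; omega

/-- Zero-sum lists of integer vectors with `d` entries bounded by `C` split into zero-sum lists of
this length. -/
def zeroSumBound (C : ℕ) : ℕ → ℕ
  | 0 => 1
  | d + 1 => zeroSumBound C d * (2 * (zeroSumBound C d * C) + 1)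

theorem abs_sum_map_le {ι : Type*} (g : ι → ℤ) (C : ℕ) (X : List ι)
    (hX : ∀ x ∈ X, |g x| ≤ C) : |(X.map g).sum| ≤ X.length * C := by
  induction X with
  | nil => simp
  | cons x X ih =>
    rw [List.forall_mem_cons] at hX
    have := ih hX.2
    have h2 := abs_add_le (g x) (X.map g).sum
    simp only [List.map_cons, List.sum_cons, List.length_cons, Nat.cast_add, Nat.cast_one]
    linarith [hX.1]

/-- One coordinate at a time: blocks that vanish in the coordinates treated so far have bounded sums
in the next one, and are grouped by the scalar case. -/
theorem exists_zero_sum_blocks {ι κ : Type*} (f : ι → κ → ℤ) (C : ℕ) (K : List κ) (X : List ι)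
    (hX : ∀ x ∈ X, ∀ j ∈ K, |f x j| ≤ C) (h0 : ∀ j ∈ K, (X.map (f · j)).sum = 0) :
    ∃ Y : List (List ι), X.Perm Y.flatten ∧
      ∀ y ∈ Y, y.length ≤ zeroSumBound C K.length ∧ ∀ j ∈ K, (y.map (f · j)).sum = 0 := by
  induction K with
  | nil =>
    exact ⟨X.map fun x => [x], by rw [← List.flatMap_def]; simp, by simp [zeroSumBound]⟩
  | cons j K ih =>
    obtain ⟨Y, hY, hYb⟩ := ih (fun x hx j hj => hX x hx j (List.mem_cons_of_mem _ hj))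
      (fun j hj => h0 j (List.mem_cons_of_mem _ hj))
    have hflat : ∀ (g : ι → ℤ) (W : List (List ι)),
        (W.flatten.map g).sum = (W.map fun y => (y.map g).sum).sum := by
      intro g W
      rw [List.map_flatten, List.sum_flatten, List.map_map]
      rfl
    obtain ⟨W, hW, hWb⟩ := exists_zero_sum_blocks_single (fun y : List ι => (y.map (f · j)).sum)
      (zeroSumBound C K.length * C) Y
      (fun y hy => by
        refine (abs_sum_map_le (f · j) C y fun x hx => hX x ?_ j List.mem_cons_self).trans ?_
        · exact hY.mem_iff.2 (List.mem_flatten.2 ⟨y, hy, hx⟩)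
        · have := (hYb y hy).1
          exact_mod_cast Nat.mul_le_mul_right C this)
      (by rw [← hflat, ← (hY.map (f · j)).sum_eq]; exact h0 j List.mem_cons_self)
    have hmem : ∀ w ∈ W, ∀ y ∈ w, y ∈ Y := fun w hw y hy =>
      hW.mem_iff.2 (List.mem_flatten.2 ⟨w, hw, hy⟩)
    refine ⟨W.map List.flatten, ?_, ?_⟩
    · rw [← List.flatten_flatten]
      exact hY.trans hW.flatten
    · simp only [List.mem_map]
      rintro _ ⟨w, hw, rfl⟩
      refine ⟨?_, List.forall_mem_cons.2 ⟨by rw [hflat]; exact (hWb w hw).2, fun i hi => ?_⟩⟩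
      · rw [List.length_flatten]
        refine (List.sum_le_card_nsmul _ (zeroSumBound C K.length) ?_).trans ?_
        · simp only [List.mem_map]
          rintro _ ⟨y, hy, rfl⟩
          exact (hYb y (hmem w hw y hy)).1
        · rw [List.length_map, smul_eq_mul, mul_comm, List.length_cons, zeroSumBound]
          exact Nat.mul_le_mul_left _ (hWb w hw).1
      · rw [hflat]
        refine List.sum_eq_zero ?_
        simp only [List.mem_map]
        rintro _ ⟨y, hy, rfl⟩
        exact (hYb y (hmem w hw y hy)).2 i hi

/-! ### Loops in runs of a DFA -/

namespace DFA

variable {α σ : Type*} (M : DFA α σ)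

/-- The run of `M` from `q` on `u` visits `s`. -/
def Visits (q : σ) (u : List α) (s : σ) : Prop := ∃ x, x <+: u ∧ M.evalFrom q x = s

variable {M}

theorem Visits.mono {q s : σ} {u v : List α} (h : M.Visits q u s) (huv : u <+: v) :
    M.Visits q v s :=
  let ⟨x, hx, hs⟩ := h
  ⟨x, hx.trans huv, hs⟩

theorem visits_start (q : σ) (u : List α) : M.Visits q u q := ⟨[], List.nil_prefix, rfl⟩

theorem visits_append {q s : σ} {u v : List α} :
    M.Visits q (u ++ v) s ↔ M.Visits q u s ∨ M.Visits (M.evalFrom q u) v s := by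
  constructor
  · rintro ⟨x, hx, hs⟩
    rcases le_total x.length u.length with h | h
    · exact Or.inl ⟨x, List.prefix_of_prefix_length_le hx (List.prefix_append _ _) h, hs⟩
    · obtain ⟨y, rfl⟩ := List.prefix_of_prefix_length_le (List.prefix_append _ _) hx h
      exact Or.inr ⟨y, (List.prefix_append_right_inj _).1 hx, by rw [← hs, evalFrom_of_append]⟩
  · rintro (h | ⟨x, hx, hs⟩)
    · exact h.mono (List.prefix_append _ _)
    · exact ⟨u ++ x, (List.prefix_append_right_inj _).2 hx, by rw [evalFrom_of_append, hs]⟩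

/-- A loop inserted where the run visits its state changes neither the end state nor loses a visited
state, so the loops can be inserted one after another. -/
theorem exists_perm_append_loops {q : σ} (Z : List (List α)) (b : List α)
    (hZ : ∀ z ∈ Z, ∃ s, M.Visits q b s ∧ M.evalFrom s z = s) :
    ∃ u, u.Perm (b ++ Z.flatten) ∧ M.evalFrom q u = M.evalFrom q b := by
  induction Z generalizing b with
  | nil => exact ⟨b, by simp, rfl⟩
  | cons z Z ih =>
    rw [List.forall_mem_cons] at hZ
    obtain ⟨⟨_, ⟨x, ⟨y, rfl⟩, rfl⟩, hz⟩, hZ⟩ := hZ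
    obtain ⟨u, hu, he⟩ := ih (x ++ (z ++ y)) fun z' hz' => by
      obtain ⟨s, hs, hl⟩ := hZ z' hz'
      refine ⟨s, ?_, hl⟩
      rw [visits_append] at hs ⊢
      refine hs.imp_right fun h => ?_
      rw [visits_append, hz]
      exact Or.inr h
    refine ⟨u, hu.trans ?_, ?_⟩
    · rw [List.flatten_cons, List.append_assoc, List.append_assoc, List.append_assoc]
      refine List.Perm.append_left _ ?_
      rw [← List.append_assoc, ← List.append_assoc]
      exact List.perm_append_comm.append_right _
    · rw [he, evalFrom_of_append, evalFrom_of_append, hz, evalFrom_of_append]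

variable [Fintype σ]

theorem _root_.exists_eq_succ_of_monotone {V : ℕ → Finset σ} (hV : Monotone V)
    (h0 : (V 0).Nonempty) : ∃ i < Fintype.card σ, V i = V (i + 1) := by
  by_contra! h
  have key : ∀ i ≤ Fintype.card σ, i < (V i).card := by
    intro i
    induction i with
    | zero => exact fun _ => h0.card_pos
    | succ i ih =>
      intro hi
      have h1 := ih (by omega)
      have h2 := Finset.card_lt_card ((hV (Nat.le_succ i)).lt_of_ne (h i (by omega)))
      simp only [Nat.succ_eq_add_one] at h2
      omega
  exact absurd (key _ le_rfl) (not_lt.2 (Finset.card_le_univ _))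

/-- With `N` states, the first `N * N` letters form `N` factors of length `N`. New states cannot
appear in all of them, and a factor without new states contains a loop, whose removal loses no
visited state. -/
theorem exists_removable_loop (q : σ) (u : List α)
    (hu : Fintype.card σ * Fintype.card σ ≤ u.length) :
    ∃ x z y, u = x ++ z ++ y ∧ z ≠ [] ∧ z.length ≤ Fintype.card σ ∧
      M.evalFrom (M.evalFrom q x) z = M.evalFrom q x ∧
      ∀ s, M.Visits q u s → M.Visits q (x ++ y) s := by
  classical
  set N := Fintype.card σ with hN
  obtain ⟨i, hi, hV⟩ := exists_eq_succ_of_monotone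
    (V := fun i => Finset.univ.filter (M.Visits q (u.take (i * N)))) (fun i j hij s hs => by
      simp only [Finset.mem_filter, Finset.mem_univ, true_and] at hs ⊢
      exact hs.mono (List.take_prefix_take_left (Nat.mul_le_mul_right N hij)))
    ⟨q, by simpa using visits_start q _⟩
  rw [← hN] at hi
  have hiN : (i + 1) * N ≤ u.length := (Nat.mul_le_mul_right N hi).trans hu
  have hadd : (i + 1) * N = i * N + N := by ring
  set u₁ := u.take (i * N) with hu₁
  set f := (u.drop (i * N)).take N with hf
  have hu₁f : u.take ((i + 1) * N) = u₁ ++ f := by rw [hadd, List.take_add]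
  have hfl : f.length = N := by
    rw [hf, List.length_take, List.length_drop]; omega
  have huf : u = u₁ ++ f ++ u.drop ((i + 1) * N) := by
    rw [← hu₁f, List.take_append_drop]
  obtain ⟨p, a, z, c, habc, hl, hz, ha, hb, hc⟩ :=
    M.evalFrom_split (x := f) (s := M.evalFrom q u₁) (by rw [hfl]) rfl
  refine ⟨u₁ ++ a, z, c ++ u.drop ((i + 1) * N), ?_, hz, by omega, ?_, ?_⟩
  · conv_lhs => rw [huf, habc]
    simp
  · rw [evalFrom_of_append, ha, hb]
  · intro s hs
    rw [huf, visits_append] at hs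
    rcases hs with hs | hs
    · have : s ∈ Finset.univ.filter (M.Visits q (u.take ((i + 1) * N))) := by
        simpa [hu₁f] using hs
      rw [← hV] at this
      have h : M.Visits q u₁ s := by simpa using this
      exact h.mono (by rw [List.append_assoc]; exact List.prefix_append _ _)
    · rw [← List.append_assoc, visits_append]
      right
      rw [evalFrom_of_append, evalFrom_of_append, ha, hc]
      rwa [evalFrom_of_append] at hs

/-- Loops are removed until the word is short. The base still visits every state of the original
run, so any selection of the loops can be put back. -/
theorem exists_base_loops (q : σ) (u : List α) :
    ∃ (b : List α) (Z : List (List α)), u.Perm (b ++ Z.flatten) ∧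
      b.length ≤ Fintype.card σ * Fintype.card σ ∧ M.evalFrom q b = M.evalFrom q u ∧
      (∀ s, M.Visits q u s → M.Visits q b s) ∧
      ∀ z ∈ Z, z.length ≤ Fintype.card σ ∧ ∃ s, M.Visits q u s ∧ M.evalFrom s z = s := by
  induction hn : u.length using Nat.strong_induction_on generalizing u with
  | _ n ih =>
    rcases le_or_gt u.length (Fintype.card σ * Fintype.card σ) with h | h
    · exact ⟨u, [], by simp, h, rfl, fun _ => id, by simp⟩
    obtain ⟨x, z, y, rfl, hz, hzl, hloop, hvis⟩ := M.exists_removable_loop q u h.le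
    have := List.length_pos_iff.2 hz
    obtain ⟨b, Z, hp, hb, he, hv, hZ⟩ := ih (x ++ y).length
      (by simp only [List.length_append] at hn ⊢; omega) (x ++ y) rfl
    have hxz : M.Visits q (x ++ z ++ y) (M.evalFrom q x) :=
      ⟨x, by rw [List.append_assoc]; exact List.prefix_append _ _, rfl⟩
    refine ⟨b, z :: Z, ?_, hb, ?_, fun s hs => hv s (hvis s hs),
      List.forall_mem_cons.2 ⟨⟨hzl, _, hxz, hloop⟩, fun z' hz' => ?_⟩⟩
    · rw [List.flatten_cons]
      refine (List.perm_append_comm.append_right _).trans ?_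
      rw [List.append_assoc]
      refine (hp.append_left z).trans ?_
      rw [← List.append_assoc, ← List.append_assoc]
      exact List.perm_append_comm.append_right _
    · rw [he, evalFrom_of_append, evalFrom_of_append, evalFrom_of_append, hloop]
    · obtain ⟨hl, s, hs, he⟩ := hZ z' hz'
      refine ⟨hl, s, ?_, he⟩
      rw [visits_append] at hs ⊢
      refine hs.imp (fun h => h.mono (List.prefix_append _ _)) fun h => ?_
      rwa [evalFrom_of_append, hloop]

end DFA

/-! ### Short words with equal Parikh images -/

/-- Two regular languages over `m` letters, given by DFAs with `N₁` and `N₂` states, that contain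
words with equal Parikh images contain such words of this length. -/
def parikhBound (m N₁ N₂ : ℕ) : ℕ :=
  zeroSumBound (N₁ * N₁ + N₂ * N₂) m * (N₁ * N₁ + N₂ * N₂)

theorem sum_map_count_sub {α : Type*} [DecidableEq α] (y : List (List α × List α)) (a : α) :
    (y.map fun x => (x.1.count a : ℤ) - x.2.count a).sum =
      ((y.map Prod.fst).flatten.count a : ℤ) - (y.map Prod.snd).flatten.count a := by
  induction y with
  | nil => rfl
  | cons x y ih =>
    simp only [List.map_cons, List.sum_cons, ih, List.flatten_cons, List.count_append]
    push_cast
    ring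

theorem length_flatten_le {α : Type*} {Y : List (List α)} {C : ℕ}
    (h : ∀ y ∈ Y, y.length ≤ C) : Y.flatten.length ≤ Y.length * C := by
  rw [List.length_flatten]
  refine (List.sum_le_card_nsmul _ C ?_).trans (by simp)
  simpa using h

/-- Counted with multiplicity, one copy of `b` is taken out on both sides, so the rest of `y` comes
from `X` even if `b` also occurs there. -/
theorem exists_perm_cons_of_perm_flatten {ι : Type*} {X : List ι} {Y : List (List ι)} {b : ι}
    {y : List ι} (h : (b :: X).Perm Y.flatten) (hy : y ∈ Y) (hb : b ∈ y) :
    ∃ X', y.Perm (b :: X') ∧ ∀ x ∈ X', x ∈ X := by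
  classical
  have h1 := List.perm_cons_erase hb
  refine ⟨_, h1, fun x hx => ?_⟩
  have h2 : (b :: X).Perm (b :: (y.erase b ++ (Y.erase y).flatten)) :=
    h.trans ((List.perm_cons_erase hy).flatten.trans (by
      rw [List.flatten_cons]
      exact h1.append_right _))
  exact ((List.perm_cons _).1 h2).mem_iff.2 (List.mem_append_left _ hx)

theorem exists_perm_of_perm {α σ₁ σ₂ : Type*} [Fintype α] [Fintype σ₁] [Fintype σ₂]
    (M₁ : DFA α σ₁) (M₂ : DFA α σ₂) {u v : List α} (huv : u.Perm v) (hu : u ∈ M₁.accepts)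
    (hv : v ∈ M₂.accepts) :
    ∃ u' v' : List α, u'.Perm v' ∧ u' ∈ M₁.accepts ∧ v' ∈ M₂.accepts ∧
      u'.length ≤ parikhBound (Fintype.card α) (Fintype.card σ₁) (Fintype.card σ₂) := by
  classical
  obtain ⟨b₁, Z₁, hp₁, hl₁, he₁, hv₁, hZ₁⟩ := M₁.exists_base_loops M₁.start u
  obtain ⟨b₂, Z₂, hp₂, hl₂, he₂, hv₂, hZ₂⟩ := M₂.exists_base_loops M₂.start v
  set N₁ := Fintype.card σ₁
  set N₂ := Fintype.card σ₂
  set C := N₁ * N₁ + N₂ * N₂ with hC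
  have hN₁ : N₁ ≤ C := (Nat.le_mul_self N₁).trans (Nat.le_add_right _ _)
  have hN₂ : N₂ ≤ C := (Nat.le_mul_self N₂).trans (Nat.le_add_left _ _)
  -- Each loop becomes a pair with an empty partner. Differences of letter counts then sum to zero
  -- over the pair of bases and all loops.
  set X : List (List α × List α) := Z₁.map (·, []) ++ Z₂.map ([], ·) with hX
  have hfst : ((((b₁, b₂) :: X).map Prod.fst).flatten) = b₁ ++ Z₁.flatten := by
    simp [hX, Function.comp_def]
  have hsnd : ((((b₁, b₂) :: X).map Prod.snd).flatten) = b₂ ++ Z₂.flatten := by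
    simp [hX, Function.comp_def]
  have hlen : ∀ x ∈ (b₁, b₂) :: X, x.1.length ≤ C ∧ x.2.length ≤ C := by
    simp only [hX, List.mem_cons, List.mem_append, List.mem_map]
    rintro x (rfl | ⟨z, hz, rfl⟩ | ⟨z, hz, rfl⟩)
    · exact ⟨by simp only; omega, by simp only; omega⟩
    · exact ⟨(hZ₁ z hz).1.trans hN₁, by simp⟩
    · exact ⟨by simp, (hZ₂ z hz).1.trans hN₂⟩
  obtain ⟨Y, hY, hYb⟩ := exists_zero_sum_blocks
    (fun (x : List α × List α) a => (x.1.count a : ℤ) - x.2.count a) C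
    (Finset.univ : Finset α).toList ((b₁, b₂) :: X)
    (fun x hx a _ => by
      have h1 := List.count_le_length (a := a) (l := x.1)
      have h2 := List.count_le_length (a := a) (l := x.2)
      have h3 := hlen x hx
      rw [abs_le]
      constructor <;> omega)
    (fun a _ => by
      rw [sum_map_count_sub, hfst, hsnd, ← hp₁.count_eq, ← hp₂.count_eq, huv.count_eq, sub_self])
  -- Only the zero-sum block with the two bases is kept; its loops are put back into the bases.
  obtain ⟨y, hy, hby⟩ := List.mem_flatten.1 (hY.mem_iff.1 List.mem_cons_self)
  obtain ⟨X', hyX', hX'⟩ := exists_perm_cons_of_perm_flatten hY hy hby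
  obtain ⟨u', hu', hue⟩ := M₁.exists_perm_append_loops (q := M₁.start) (X'.map Prod.fst) b₁ <| by
    simp only [List.mem_map]
    rintro _ ⟨x, hx, rfl⟩
    have := hX' x hx
    simp only [hX, List.mem_append, List.mem_map] at this
    rcases this with ⟨z, hz, rfl⟩ | ⟨z, hz, rfl⟩
    · obtain ⟨-, s, hs, hl⟩ := hZ₁ z hz
      exact ⟨s, hv₁ s hs, hl⟩
    · exact ⟨_, DFA.visits_start _ _, rfl⟩
  obtain ⟨v', hv', hve⟩ := M₂.exists_perm_append_loops (q := M₂.start) (X'.map Prod.snd) b₂ <| by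
    simp only [List.mem_map]
    rintro _ ⟨x, hx, rfl⟩
    have := hX' x hx
    simp only [hX, List.mem_append, List.mem_map] at this
    rcases this with ⟨z, hz, rfl⟩ | ⟨z, hz, rfl⟩
    · exact ⟨_, DFA.visits_start _ _, rfl⟩
    · obtain ⟨-, s, hs, hl⟩ := hZ₂ z hz
      exact ⟨s, hv₂ s hs, hl⟩
  have hyu : (y.map Prod.fst).flatten.Perm u' := (hyX'.map Prod.fst).flatten.trans hu'.symm
  have hyv : (y.map Prod.snd).flatten.Perm v' := (hyX'.map Prod.snd).flatten.trans hv'.symm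
  refine ⟨u', v', ?_, ?_, ?_, ?_⟩
  · refine List.perm_iff_count.2 fun a => ?_
    have := (hYb y hy).2 a (by simp)
    rw [sum_map_count_sub, hyu.count_eq, hyv.count_eq] at this
    omega
  · rw [DFA.mem_accepts] at hu ⊢
    rwa [DFA.eval, hue, he₁]
  · rw [DFA.mem_accepts] at hv ⊢
    rwa [DFA.eval, hve, he₂]
  · rw [← hyu.length_eq]
    refine (length_flatten_le (C := C) ?_).trans ?_
    · simp only [List.mem_map]
      rintro _ ⟨x, hx, rfl⟩
      exact (hlen x (hY.mem_iff.2 (List.mem_flatten.2 ⟨y, hy, hx⟩))).1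
    · rw [List.length_map, parikhBound, ← hC]
      refine Nat.mul_le_mul_right _ ?_
      simpa using (hYb y hy).1

theorem zeroSumBound_mono {C C' : ℕ} (h : C ≤ C') (d : ℕ) :
    zeroSumBound C d ≤ zeroSumBound C' d := by
  induction d with
  | zero => exact le_rfl
  | succ d ih =>
    simp only [zeroSumBound]
    gcongr

theorem parikhBound_mono {N₁ N₂ N₁' N₂' : ℕ} (m : ℕ) (h₁ : N₁ ≤ N₁') (h₂ : N₂ ≤ N₂') :
    parikhBound m N₁ N₂ ≤ parikhBound m N₁' N₂' := by
  unfold parikhBound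
  have : N₁ * N₁ + N₂ * N₂ ≤ N₁' * N₁' + N₂' * N₂' := by gcongr
  exact Nat.mul_le_mul (zeroSumBound_mono this m) this

theorem HasDFA.exists_perm_of_perm {m N₁ N₂ : ℕ} {L₁ L₂ : Language (Fin m)} (h₁ : HasDFA L₁ N₁)
    (h₂ : HasDFA L₂ N₂) {u v : List (Fin m)} (huv : u.Perm v) (hu : u ∈ L₁) (hv : v ∈ L₂) :
    ∃ u' v' : List (Fin m), u'.Perm v' ∧ u' ∈ L₁ ∧ v' ∈ L₂ ∧ u'.length ≤ parikhBound m N₁ N₂ := by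
  obtain ⟨n₁, hn₁, M₁, rfl⟩ := h₁
  obtain ⟨n₂, hn₂, M₂, rfl⟩ := h₂
  obtain ⟨u', v', h, hu', hv', hl⟩ := _root_.exists_perm_of_perm M₁ M₂ huv hu hv
  exact ⟨u', v', h, hu', hv', hl.trans (by simpa using parikhBound_mono m hn₁ hn₂)⟩

/-! ### Short witnesses and Boolean operations -/

theorem DFA.exists_short_of_evalFrom {α σ : Type*} [Fintype σ] (M : DFA α σ) (q : σ) (u : List α) :
    ∃ u' : List α, u'.length ≤ Fintype.card σ ∧ M.evalFrom q u' = M.evalFrom q u := by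
  induction hn : u.length using Nat.strong_induction_on generalizing u with
  | _ n ih =>
    rcases le_or_gt u.length (Fintype.card σ) with h | h
    · exact ⟨u, h, rfl⟩
    obtain ⟨p, a, b, c, rfl, -, hb, ha, hbp, hc⟩ := M.evalFrom_split h.le (s := q) rfl
    have := List.length_pos_iff.2 hb
    obtain ⟨u', hl, he⟩ := ih (a ++ c).length
      (by simp only [List.length_append] at hn ⊢; omega) (a ++ c) rfl
    refine ⟨u', hl, he.trans ?_⟩
    rw [evalFrom_of_append, ha, hc]

theorem HasDFA.exists_short {α : Type*} {L : Language α} {N : ℕ} (h : HasDFA L N) {u : List α}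
    (hu : u ∈ L) : ∃ u' ∈ L, u'.length ≤ N := by
  obtain ⟨n, hn, M, rfl⟩ := h
  obtain ⟨u', hl, he⟩ := M.exists_short_of_evalFrom M.start u
  refine ⟨u', ?_, hl.trans (by simpa using hn)⟩
  rw [DFA.mem_accepts] at hu ⊢
  rwa [DFA.eval, he]

theorem HasDFA.compl {α : Type*} {L : Language α} {N : ℕ} (h : HasDFA L N) : HasDFA Lᶜ N := by
  obtain ⟨n, hn, M, rfl⟩ := h
  exact ⟨n, hn, Mᶜ, M.accepts_compl⟩

theorem HasDFA.inf {α : Type*} {L₁ L₂ : Language α} {N₁ N₂ : ℕ} (h₁ : HasDFA L₁ N₁)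
    (h₂ : HasDFA L₂ N₂) : HasDFA (L₁ ⊓ L₂) (N₁ * N₂) := by
  obtain ⟨n₁, hn₁, M₁, rfl⟩ := h₁
  obtain ⟨n₂, hn₂, M₂, rfl⟩ := h₂
  rw [← DFA.accepts_inter]
  exact DFA.hasDFA _ (by simpa using Nat.mul_le_mul hn₁ hn₂)

/-- Either difference of the languages has a product DFA with at most `N₁ * N₂` states, hence a
short word if it is nonempty. -/
theorem HasDFA.eq_of_short {α : Type*} {L₁ L₂ : Language α} {N₁ N₂ : ℕ} (h₁ : HasDFA L₁ N₁)
    (h₂ : HasDFA L₂ N₂) (h : ∀ w, w.length ≤ N₁ * N₂ → (w ∈ L₁ ↔ w ∈ L₂)) : L₁ = L₂ := by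
  ext w
  by_contra hw
  rcases not_iff.1 hw with hw
  by_cases hw₁ : w ∈ L₁
  · have hw₂ : w ∉ L₂ := fun h => (hw.2 h) hw₁
    obtain ⟨w', ⟨h₁', h₂'⟩, hl⟩ := (h₁.inf h₂.compl).exists_short (u := w) ⟨hw₁, hw₂⟩
    exact h₂' ((h w' hl).1 h₁')
  · obtain ⟨w', ⟨h₁', h₂'⟩, hl⟩ := (h₁.compl.inf h₂).exists_short (u := w) ⟨hw₁, hw.1 hw₁⟩
    exact h₁' ((h w' hl).2 h₂')

theorem NFA.hasDFA {α : Type*} {n : ℕ} (M : NFA α (Fin n)) : HasDFA M.accepts (2 ^ n) := by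
  rw [← M.toDFA_correct]
  exact DFA.hasDFA _ (by simp)

/-! ### Primitive recursive bounds and enumerations -/

section Primrec

variable {α β : Type*} [Primcodable α] [Primcodable β]

theorem PrimrecPred.exists_mem {f : α → List β} {p : α × β → Prop} (hf : Primrec f)
    (hp : PrimrecPred p) : PrimrecPred fun a => ∃ b ∈ f a, p (a, b) := by
  have hR : PrimrecRel fun (b : β) (a : α) => p (a, b) := hp.comp (Primrec.snd.pair Primrec.fst)
  exact hR.exists_mem_list.comp hf Primrec.id

theorem PrimrecPred.forall_mem {f : α → List β} {p : α × β → Prop} (hf : Primrec f)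
    (hp : PrimrecPred p) : PrimrecPred fun a => ∀ b ∈ f a, p (a, b) := by
  have hR : PrimrecRel fun (b : β) (a : α) => p (a, b) := hp.comp (Primrec.snd.pair Primrec.fst)
  exact hR.forall_mem_list.comp hf Primrec.id

theorem PrimrecPred.mem_list {f : α → β} {g : α → List β} (hf : Primrec f) (hg : Primrec g) :
    PrimrecPred fun a => f a ∈ g a :=
  (PrimrecPred.exists_mem (p := fun x : α × β => x.2 = f x.1) hg
    (Primrec.eq.comp Primrec.snd (hf.comp Primrec.fst))).of_eq fun a => by simp

theorem PrimrecPred.iff {p q : α → Prop} (hp : PrimrecPred p) (hq : PrimrecPred q) :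
    PrimrecPred fun a => (p a ↔ q a) :=
  ((hp.and hq).or (hp.not.and hq.not)).of_eq fun a => by tauto

theorem PrimrecPred.listFilter_mem {f : α → List β} {p : α × β → Prop} [DecidablePred p]
    (hf : Primrec f) (hp : PrimrecPred p) :
    Primrec fun a => (f a).filter fun b => decide (p (a, b)) := by
  have hR : PrimrecRel fun (b : β) (a : α) => p (a, b) := hp.comp (Primrec.snd.pair Primrec.fst)
  exact hR.listFilter.comp hf Primrec.id

theorem Primrec.nat_pow : Primrec₂ ((· ^ ·) : ℕ → ℕ → ℕ) :=
  Primrec₂.unpaired'.1 Nat.Primrec.pow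

end Primrec

/-- The words of length at most `n` over the letters below `m`. -/
def words (m : ℕ) : ℕ → List (List ℕ)
  | 0 => [[]]
  | n + 1 => [] :: (words m n).flatMap fun w => (List.range m).map (· :: w)

theorem mem_words {m n : ℕ} {w : List ℕ} :
    w ∈ words m n ↔ w.length ≤ n ∧ ∀ a ∈ w, a < m := by
  induction n generalizing w with
  | zero => cases w <;> simp [words]
  | succ n ih =>
    cases w with
    | nil => simp [words]
    | cons a w =>
      simp [words, ih]
      tauto

theorem primrec_words : Primrec₂ words := by
  have := Primrec.nat_rec (f := fun _ : ℕ => ([[]] : List (List ℕ)))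
    (g := fun m (x : ℕ × List (List ℕ)) => [] :: x.2.flatMap fun w => (List.range m).map (· :: w))
    (Primrec.const _) <| by
    refine Primrec.list_cons.comp (Primrec.const []) ?_
    refine Primrec.list_flatMap (Primrec.snd.comp Primrec.snd) ?_
    refine Primrec.list_map (Primrec.list_range.comp (Primrec.fst.comp Primrec.fst)) ?_
    exact Primrec.list_cons.comp Primrec.snd (Primrec.snd.comp Primrec.fst)
  refine this.of_eq fun m n => ?_
  induction n with
  | zero => rfl
  | succ n ih => simp only [words, ← ih]

theorem mem_words_iff_exists_fin {m n : ℕ} {w : List ℕ} :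
    w ∈ words m n ↔ ∃ v : List (Fin m), v.length ≤ n ∧ v.map Fin.val = w := by
  rw [mem_words]
  constructor
  · rintro ⟨hl, hw⟩
    lift w to List (Fin m) using hw
    exact ⟨w, by simpa using hl, rfl⟩
  · rintro ⟨v, hv, rfl⟩
    simp [hv]

/-- The total length of the walk from `0` through the entries of a list. -/
def walkLength (l : List ℕ) : ℕ :=
  -- The state holds the current point and the length so far; the two truncated differences add up
  -- to the distance.
  (l.foldl (fun s y => (y, s.2 + ((y - s.1) + (s.1 - y)))) ((0, 0) : ℕ × ℕ)).2

theorem walkLength_eq (l : List ℕ) : walkLength l = pathDist 0 (l.map fun i : ℕ => (i : ℤ)) := by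
  have key : ∀ (l : List ℕ) (x t : ℕ),
      (l.foldl (fun s y => (y, s.2 + ((y - s.1) + (s.1 - y)))) ((x, t) : ℕ × ℕ)).2 =
        t + pathDist x (l.map fun i : ℕ => (i : ℤ)) := by
    intro l
    induction l with
    | nil => simp [pathDist]
    | cons y l ih =>
      intro x t
      rw [List.foldl_cons, ih, List.map_cons, pathDist]
      omega
  simpa [walkLength] using key l 0 0

theorem primrec_walkLength : Primrec walkLength := by
  refine Primrec.snd.comp (Primrec.list_foldl
    (h := fun _ (x : (ℕ × ℕ) × ℕ) => (x.2, x.1.2 + ((x.2 - x.1.1) + (x.1.1 - x.2))))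
    Primrec.id (Primrec.const (0, 0)) ?_)
  have hs : Primrec fun x : List ℕ × (ℕ × ℕ) × ℕ => x.2.1 := Primrec.fst.comp Primrec.snd
  have hy : Primrec fun x : List ℕ × (ℕ × ℕ) × ℕ => x.2.2 := Primrec.snd.comp Primrec.snd
  have h1 := Primrec.fst.comp hs
  have h2 := Primrec.snd.comp hs
  exact hy.pair (Primrec.nat_add.comp h2
    (Primrec.nat_add.comp (Primrec.nat_sub.comp hy h1) (Primrec.nat_sub.comp h1 hy)))

theorem primrec_costBound : Primrec₂ costBound := by
  have h2 : Primrec fun x : ℕ × ℕ => 2 ^ x.1 :=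
    Primrec.nat_pow.comp (Primrec.const 2) Primrec.fst
  have hk : Primrec fun x : ℕ × ℕ => x.2 + 1 := Primrec.succ.comp Primrec.snd
  exact Primrec.nat_pow.comp (Primrec.const 2) (Primrec.nat_mul.comp (Primrec.nat_pow.comp
    (Primrec.succ.comp (Primrec.nat_pow.comp h2 h2)) hk) hk)

theorem primrec_zeroSumBound : Primrec₂ zeroSumBound := by
  have := Primrec.nat_rec (f := fun _ : ℕ => 1)
    (g := fun C (x : ℕ × ℕ) => x.2 * (2 * (x.2 * C) + 1)) (Primrec.const _) <| by
    have hr : Primrec fun x : ℕ × ℕ × ℕ => x.2.2 := Primrec.snd.comp Primrec.snd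
    exact Primrec.nat_mul.comp hr (Primrec.succ.comp (Primrec.nat_mul.comp (Primrec.const 2)
      (Primrec.nat_mul.comp hr Primrec.fst)))
  refine this.of_eq fun C d => ?_
  induction d with
  | zero => rfl
  | succ d ih => simp only [zeroSumBound, ← ih]

theorem primrec_parikhBound {α : Type*} [Primcodable α] {m N₁ N₂ : α → ℕ} (hm : Primrec m)
    (h₁ : Primrec N₁) (h₂ : Primrec N₂) : Primrec fun a => parikhBound (m a) (N₁ a) (N₂ a) := by
  have hC := Primrec.nat_add.comp (Primrec.nat_mul.comp h₁ h₁) (Primrec.nat_mul.comp h₂ h₂)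
  exact Primrec.nat_mul.comp (primrec_zeroSumBound.comp hC hm) hC

/-! ### Deciding acceptance and cost of a single word -/

namespace FinNFA

theorem primrec_equivTuple : Primrec equivTuple := Primrec.of_equiv

theorem primrec_letters : Primrec letters := Primrec.fst.comp primrec_equivTuple

theorem primrec_states : Primrec states :=
  Primrec.fst.comp (Primrec.snd.comp primrec_equivTuple)

theorem primrec_transitions : Primrec transitions :=
  Primrec.fst.comp (Primrec.snd.comp (Primrec.snd.comp primrec_equivTuple))

theorem primrec_initial : Primrec initial :=
  Primrec.fst.comp (Primrec.snd.comp (Primrec.snd.comp (Primrec.snd.comp primrec_equivTuple)))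

theorem primrec_accepting : Primrec accepting :=
  Primrec.snd.comp (Primrec.snd.comp (Primrec.snd.comp (Primrec.snd.comp primrec_equivTuple)))

/-- The successors by `a` of the states in a list. -/
def next (A : FinNFA) (S : List ℕ) (a : ℕ) : List ℕ :=
  -- Only sources are checked for range: a target out of range is dropped at the next step or on
  -- acceptance.
  (A.transitions.filter fun t => decide (t.1 < A.states ∧ t.1 ∈ S ∧ t.2.1 = a)).map fun t => t.2.2

theorem primrec_next : Primrec fun x : FinNFA × List ℕ × ℕ => x.1.next x.2.1 x.2.2 := by
  refine Primrec.list_map (PrimrecPred.listFilter_mem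
    (p := fun y : (FinNFA × List ℕ × ℕ) × ℕ × ℕ × ℕ =>
      y.2.1 < y.1.1.states ∧ y.2.1 ∈ y.1.2.1 ∧ y.2.2.1 = y.1.2.2)
    (primrec_transitions.comp Primrec.fst) ?_) ?_
  · have h1 : Primrec fun y : (FinNFA × List ℕ × ℕ) × ℕ × ℕ × ℕ => y.2.1 :=
      Primrec.fst.comp Primrec.snd
    have h2 : Primrec fun y : (FinNFA × List ℕ × ℕ) × ℕ × ℕ × ℕ => y.1.2 :=
      Primrec.snd.comp Primrec.fst
    refine (Primrec.nat_lt.comp h1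
      (primrec_states.comp (Primrec.fst.comp Primrec.fst))).and (.and ?_ ?_)
    · exact PrimrecPred.mem_list h1 (Primrec.fst.comp h2)
    · exact Primrec.eq.comp (Primrec.fst.comp (Primrec.snd.comp Primrec.snd)) (Primrec.snd.comp h2)
  · exact Primrec.snd.comp (Primrec.snd.comp Primrec.snd)

/-- Acceptance of a word whose letters are given by numbers. -/
def Accepts (A : FinNFA) (w : List ℕ) : Prop :=
  ∃ q ∈ w.foldl A.next A.initial, q < A.states ∧ q ∈ A.accepting

theorem primrecPred_accepts {α : Type*} [Primcodable α] {A : α → FinNFA} {w : α → List ℕ}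
    (hA : Primrec A) (hw : Primrec w) : PrimrecPred fun a => (A a).Accepts (w a) := by
  refine PrimrecPred.exists_mem (p := fun x : α × ℕ => x.2 < (A x.1).states ∧
    x.2 ∈ (A x.1).accepting) (Primrec.list_foldl
    (h := fun a (x : List ℕ × ℕ) => (A a).next x.1 x.2) hw (primrec_initial.comp hA) ?_) ?_
  · exact primrec_next.comp ((hA.comp Primrec.fst).pair Primrec.snd)
  · have hA' := hA.comp (Primrec.fst (α := α) (β := ℕ))
    exact (Primrec.nat_lt.comp Primrec.snd (primrec_states.comp hA')).and
      (PrimrecPred.mem_list Primrec.snd (primrec_accepting.comp hA'))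

theorem mem_foldl_next (A : FinNFA) (S : List ℕ) (w : List (Fin A.letters)) (q : Fin A.states) :
    (q : ℕ) ∈ (w.map Fin.val).foldl A.next S ↔
      q ∈ A.toNFA.evalFrom {q | (q : ℕ) ∈ S} w := by
  induction w generalizing S with
  | nil => rfl
  | cons a w ih =>
    rw [List.map_cons, List.foldl_cons, ih, NFA.evalFrom_cons]
    have : {q : Fin A.states | (q : ℕ) ∈ A.next S a} =
        A.toNFA.stepSet {q : Fin A.states | (q : ℕ) ∈ S} a := by
      ext q
      simp only [next, toNFA, NFA.mem_stepSet, Set.mem_ofPred_eq, List.mem_map, List.mem_filter,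
        decide_eq_true_eq]
      constructor
      · rintro ⟨⟨p, b, r⟩, ⟨ht, hp, hpS, hb⟩, hr⟩
        simp only at ht hp hpS hb hr
        subst hb hr
        exact ⟨⟨p, hp⟩, hpS, ht⟩
      · rintro ⟨p, hp, ht⟩
        exact ⟨_, ⟨ht, p.isLt, hp, rfl⟩, rfl⟩
    rw [this]

theorem accepts_map_val (A : FinNFA) (w : List (Fin A.letters)) :
    A.Accepts (w.map Fin.val) ↔ w ∈ A.toNFA.accepts := by
  rw [NFA.mem_accepts]
  constructor
  · rintro ⟨q, hq, hlt, hacc⟩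
    exact ⟨⟨q, hlt⟩, hacc, (A.mem_foldl_next A.initial w ⟨q, hlt⟩).1 hq⟩
  · rintro ⟨q, hacc, hq⟩
    exact ⟨q, (A.mem_foldl_next A.initial w q).2 hq, q.isLt, hacc⟩

/-- `p` lists all positions of `w`, and `A` accepts the word read along `p`. -/
def Reads (A : FinNFA) (w p : List ℕ) : Prop :=
  (p.length = w.length ∧ ∀ i ∈ List.range w.length, i ∈ p) ∧ A.Accepts (p.filterMap (w[·]?))

theorem primrecPred_reads {α : Type*} [Primcodable α] {A : α → FinNFA} {w p : α → List ℕ}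
    (hA : Primrec A) (hw : Primrec w) (hp : Primrec p) :
    PrimrecPred fun a => (A a).Reads (w a) (p a) := by
  have hl := Primrec.list_length.comp hw
  refine .and (.and (Primrec.eq.comp (Primrec.list_length.comp hp) hl) ?_) ?_
  · exact PrimrecPred.forall_mem (p := fun x : α × ℕ => x.2 ∈ p x.1) (Primrec.list_range.comp hl)
      (PrimrecPred.mem_list Primrec.snd (hp.comp Primrec.fst))
  · exact primrecPred_accepts hA (Primrec.listFilterMap hp
      (Primrec.list_getElem?.comp (hw.comp Primrec.fst) Primrec.snd))

theorem reads_map_val (A : FinNFA) (w : List (Fin A.letters)) (p : List ℕ) :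
    A.Reads (w.map Fin.val) p ↔
      p.Perm (List.range w.length) ∧ p.filterMap (w[·]?) ∈ A.toNFA.accepts := by
  have h : p.filterMap ((w.map Fin.val)[·]?) = (p.filterMap (w[·]?)).map Fin.val := by
    simp [List.map_filterMap]
  rw [Reads, h, accepts_map_val, List.length_map]
  refine and_congr_left fun _ => ⟨fun ⟨hl, hp⟩ => ?_, fun hp => ⟨?_, fun i hi => hp.mem_iff.2 hi⟩⟩
  -- A list of length `n` that contains `n` distinct positions is a permutation of them.
  · exact ((List.subperm_of_subset List.nodup_range hp).perm_of_length_le (by simp [hl])).symm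
  · simpa using hp.length_eq

/-- Some jump sequence of cost at most `k` along `w` is accepted; the letters of `w` are numbers. -/
def CostLe (A : FinNFA) (k : ℕ) (w : List ℕ) : Prop :=
  ∃ p ∈ words w.length w.length, A.Reads w p ∧
    walkLength (p.map Nat.succ ++ [w.length + 1]) ≤ k + w.length + 1

/-- Some jump sequence along `w` is accepted; the letters of `w` are numbers. -/
def Jumps (A : FinNFA) (w : List ℕ) : Prop := ∃ p ∈ words w.length w.length, A.Reads w p

/-- Makes the search for jump sequences bounded: they are among the words over the positions. -/
theorem mem_words_of_perm {n : ℕ} {p : List ℕ} (h : p.Perm (List.range n)) : p ∈ words n n :=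
  mem_words.2 ⟨by simpa using h.length_eq.le, fun a ha => List.mem_range.1 (h.mem_iff.1 ha)⟩

theorem costLe_map_val (A : FinNFA) (k : ℕ) (w : List (Fin A.letters)) :
    A.CostLe k (w.map Fin.val) ↔ absCost A.toNFA w ≤ k := by
  rw [absCost_le_iff, CostLe, _root_.CostLe]
  simp only [reads_map_val, walkLength_eq, List.length_map]
  refine exists_congr fun p => ?_
  have : (p.map Nat.succ ++ [w.length + 1]).map (fun i : ℕ => (i : ℤ)) =
      p.map (fun i : ℕ => (i : ℤ) + 1) ++ [(w.length : ℤ) + 1] := by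
    simp
  rw [this]
  exact ⟨fun ⟨_, ⟨h1, h2⟩, h3⟩ => ⟨h1, h2, h3⟩,
    fun ⟨h1, h2, h3⟩ => ⟨mem_words_of_perm h1, ⟨h1, h2⟩, h3⟩⟩

theorem jumps_map_val (A : FinNFA) (w : List (Fin A.letters)) :
    A.Jumps (w.map Fin.val) ↔ w ∈ jumpingLanguage A.toNFA := by
  rw [mem_jumpingLanguage_iff, Jumps]
  simp only [reads_map_val, List.length_map]
  exact exists_congr fun p => ⟨fun h => h.2, fun h => ⟨mem_words_of_perm h.1, h⟩⟩

section

variable {α : Type*} [Primcodable α] {A : α → FinNFA} {w : α → List ℕ} {k : α → ℕ}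

theorem primrecPred_jumps (hA : Primrec A) (hw : Primrec w) :
    PrimrecPred fun a => (A a).Jumps (w a) := by
  have hl := Primrec.list_length.comp hw
  exact PrimrecPred.exists_mem (p := fun x : α × List ℕ => (A x.1).Reads (w x.1) x.2)
    (primrec_words.comp hl hl)
    (primrecPred_reads (hA.comp Primrec.fst) (hw.comp Primrec.fst) Primrec.snd)

theorem primrecPred_costLe (hA : Primrec A) (hk : Primrec k) (hw : Primrec w) :
    PrimrecPred fun a => (A a).CostLe (k a) (w a) := by
  have hl := Primrec.list_length.comp hw
  have hl' := hl.comp (Primrec.fst (α := α) (β := List ℕ))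
  refine PrimrecPred.exists_mem (p := fun x : α × List ℕ => (A x.1).Reads (w x.1) x.2 ∧
    walkLength (x.2.map Nat.succ ++ [(w x.1).length + 1]) ≤ k x.1 + (w x.1).length + 1)
    (primrec_words.comp hl hl)
    (.and (primrecPred_reads (hA.comp Primrec.fst) (hw.comp Primrec.fst) Primrec.snd)
      (Primrec.nat_le.comp (primrec_walkLength.comp (Primrec.list_append.comp
        (Primrec.list_map Primrec.snd (Primrec.succ.comp Primrec.snd))
        (Primrec.list_cons.comp (Primrec.succ.comp hl') (Primrec.const []))))
        (Primrec.succ.comp (Primrec.nat_add.comp (hk.comp Primrec.fst) hl'))))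

end

/-! ### Bounded search for counterexamples -/

theorem exists_mem_words_iff {m n : ℕ} {p : List ℕ → Prop} :
    (∃ w ∈ words m n, p w) ↔ ∃ v : List (Fin m), v.length ≤ n ∧ p (v.map Fin.val) := by
  simp only [mem_words_iff_exists_fin]
  exact ⟨fun ⟨_, ⟨v, hv, rfl⟩, h⟩ => ⟨v, hv, h⟩, fun ⟨v, hv, h⟩ => ⟨_, ⟨v, hv, rfl⟩, h⟩⟩

theorem hasDFA_absCost_le (A : FinNFA) (k : ℕ) :
    HasDFA {w | absCost A.toNFA w ≤ k} (costBound A.states k) := by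
  simp only [absCost_le_iff]
  exact hasDFA_costLe A.toNFA k

/-- A counterexample is a word of cost above `k` with an accepted permutation. Both languages are
regular with computable bounds, so the pair can be taken short. -/
theorem not_absBounded_iff (A : FinNFA) (k : ℕ) : ¬A.AbsBounded k ↔
    ∃ w ∈ words A.letters (parikhBound A.letters (2 ^ A.states) (costBound A.states k)),
      A.Jumps w ∧ ¬A.CostLe k w := by
  simp only [exists_mem_words_iff, jumps_map_val, costLe_map_val]
  constructor
  · intro h
    unfold AbsBounded at h
    push Not at h
    obtain ⟨w, ⟨u, hwu, hu⟩, hc⟩ := h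
    obtain ⟨u', v', hp, hu', hv', hl⟩ := (NFA.hasDFA A.toNFA).exists_perm_of_perm
      (A.hasDFA_absCost_le k).compl hwu.symm hu (not_le.2 hc)
    exact ⟨v', hp.length_eq ▸ hl, ⟨u', hp.symm, hu'⟩, hv'⟩
  · rintro ⟨w, -, hw, hc⟩ h
    exact hc (h w hw)

theorem not_univAbsBounded_iff (A : FinNFA) (k : ℕ) : ¬A.UnivAbsBounded k ↔
    ∃ w ∈ words A.letters (costBound A.states k), ¬A.CostLe k w := by
  simp only [exists_mem_words_iff, costLe_map_val]
  constructor
  · intro h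
    unfold UnivAbsBounded at h
    push Not at h
    obtain ⟨w, hc⟩ := h
    obtain ⟨w', hw', hl⟩ := (A.hasDFA_absCost_le k).compl.exists_short (u := w) (not_le.2 hc)
    exact ⟨w', hl, hw'⟩
  · rintro ⟨w, -, hc⟩ h
    exact hc (h w)

theorem primrecPred_absBounded :
    PrimrecPred fun p : FinNFA × ℕ => p.1.AbsBounded p.2 := by
  have hs : Primrec fun p : FinNFA × ℕ => p.1.states := primrec_states.comp Primrec.fst
  have hm : Primrec fun p : FinNFA × ℕ => p.1.letters := primrec_letters.comp Primrec.fst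
  have h1 : Primrec fun x : (FinNFA × ℕ) × List ℕ => x.1.1 := Primrec.fst.comp Primrec.fst
  refine (PrimrecPred.exists_mem
    (p := fun x : (FinNFA × ℕ) × List ℕ => x.1.1.Jumps x.2 ∧ ¬x.1.1.CostLe x.1.2 x.2)
    (primrec_words.comp hm (primrec_parikhBound hm
      (Primrec.nat_pow.comp (Primrec.const 2) hs) (primrec_costBound.comp hs Primrec.snd)))
    ((primrecPred_jumps h1 Primrec.snd).and
      (primrecPred_costLe h1 (Primrec.snd.comp Primrec.fst) Primrec.snd).not)).not.of_eq fun p => ?_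
  rw [← not_absBounded_iff, not_not]

theorem primrecPred_univAbsBounded :
    PrimrecPred fun p : FinNFA × ℕ => p.1.UnivAbsBounded p.2 := by
  refine (PrimrecPred.exists_mem
    (p := fun x : (FinNFA × ℕ) × List ℕ => ¬x.1.1.CostLe x.1.2 x.2)
    (primrec_words.comp (primrec_letters.comp Primrec.fst)
      (primrec_costBound.comp (primrec_states.comp Primrec.fst) Primrec.snd))
    (primrecPred_costLe (Primrec.fst.comp Primrec.fst) (Primrec.snd.comp Primrec.fst)
      Primrec.snd).not).not.of_eq fun p => ?_
  rw [← not_univAbsBounded_iff, not_not]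

/-! ### Construction of the NFA by unbounded search -/

/-- `B` has the alphabet of `A` and agrees with the cost bound `k` on sufficiently many words. -/
def IsCostNFA (A : FinNFA) (k : ℕ) (B : FinNFA) : Prop :=
  A.letters = B.letters ∧ ∀ w ∈ words A.letters (2 ^ B.states * costBound A.states k),
    (B.Accepts w ↔ A.CostLe k w)

theorem primrecPred_isCostNFA {α : Type*} [Primcodable α] {A B : α → FinNFA} {k : α → ℕ}
    (hA : Primrec A) (hk : Primrec k) (hB : Primrec B) :
    PrimrecPred fun a => (A a).IsCostNFA (k a) (B a) := by
  have hm := primrec_letters.comp hA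
  refine .and (Primrec.eq.comp hm (primrec_letters.comp hB)) (PrimrecPred.forall_mem
    (p := fun x : α × List ℕ => (B x.1).Accepts x.2 ↔ (A x.1).CostLe (k x.1) x.2)
    (primrec_words.comp hm (Primrec.nat_mul.comp
      (Primrec.nat_pow.comp (Primrec.const 2) (primrec_states.comp hB))
      (primrec_costBound.comp (primrec_states.comp hA) hk))) (.iff ?_ ?_))
  · exact primrecPred_accepts (hB.comp Primrec.fst) Primrec.snd
  · exact primrecPred_costLe (hA.comp Primrec.fst) (hk.comp Primrec.fst) Primrec.snd

theorem exists_isCostNFA (A : FinNFA) (k : ℕ) : ∃ B, A.IsCostNFA k B := by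
  obtain ⟨n, -, M, hM⟩ := A.hasDFA_absCost_le k
  obtain ⟨t, i, f, hB⟩ := exists_toNFA_eq M.toNFA
  refine ⟨⟨A.letters, n, t, i, f⟩, rfl, fun w hw => ?_⟩
  obtain ⟨v, -, rfl⟩ := mem_words_iff_exists_fin.1 hw
  rw [costLe_map_val]
  refine (accepts_map_val ⟨A.letters, n, t, i, f⟩ v).trans ?_
  rw [hB, M.toNFA_correct, hM]
  rfl

/-- The tested length is the product of the state bound of the determinised `B` and that of the cost
language, so agreement there is agreement everywhere. -/
theorem IsCostNFA.mem_accepts_iff {A : FinNFA} {k : ℕ} {B : FinNFA} (h : A.IsCostNFA k B) :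
    ∃ h : A.letters = B.letters, ∀ w : List (Fin A.letters),
      w.map (Fin.cast h) ∈ B.toNFA.accepts ↔ absCost A.toNFA w ≤ k := by
  obtain ⟨m, n, t, i, f⟩ := B
  obtain ⟨rfl, h⟩ := h
  refine ⟨rfl, fun w => ?_⟩
  have := (NFA.hasDFA (FinNFA.mk A.letters n t i f).toNFA).eq_of_short (A.hasDFA_absCost_le k)
    fun v hv => by
      have := h _ (mem_words_iff_exists_fin.2 ⟨v, hv, rfl⟩)
      rw [costLe_map_val] at this
      exact (accepts_map_val ⟨A.letters, n, t, i, f⟩ v).symm.trans this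
  have e : w.map (Fin.cast (rfl : A.letters = A.letters)) = w :=
    (List.map_congr_left fun _ _ => rfl).trans (List.map_id w)
  refine (iff_of_eq (congrArg (· ∈ (FinNFA.mk A.letters n t i f).toNFA.accepts) e)).trans ?_
  rw [this]
  rfl

theorem exists_computable_isCostNFA :
    ∃ B : FinNFA × ℕ → FinNFA, Computable B ∧ ∀ p : FinNFA × ℕ, p.1.IsCostNFA p.2 (B p) := by
  classical
  -- The search runs over codes; the empty presentation stands in for numbers that code nothing.
  have hdec : Primrec fun c : ℕ => (Encodable.decode c : Option FinNFA).getD ⟨0, 0, [], [], []⟩ :=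
    Primrec.option_getD.comp Primrec.decode (Primrec.const _)
  have hex : ∀ p : FinNFA × ℕ, ∃ c : ℕ, p.1.IsCostNFA p.2
      ((Encodable.decode c : Option FinNFA).getD ⟨0, 0, [], [], []⟩) := fun p => by
    obtain ⟨B, hB⟩ := p.1.exists_isCostNFA p.2
    exact ⟨Encodable.encode B, by simpa using hB⟩
  exact ⟨_, hdec.to_comp.comp (Computable.find (PrimrecPred.computablePred (primrecPred_isCostNFA
    (Primrec.fst.comp Primrec.fst) (Primrec.snd.comp Primrec.fst) (hdec.comp Primrec.snd))) hex),
    fun p => Nat.find_spec (hex p)⟩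

end FinNFA

theorem mainTheorem1 :
    -- an NFA for `{w | absCost A w ≤ k}`, over the alphabet of `A`, can be computed from `A` and `k`
    (∃ B : FinNFA × ℕ → FinNFA, Computable B ∧
      ∀ (A : FinNFA) (k : ℕ), ∃ h : A.letters = (B (A, k)).letters,
        ∀ w : List (Fin A.letters),
          w.map (Fin.cast h) ∈ (B (A, k)).toNFA.accepts ↔ absCost A.toNFA w ≤ k) ∧
    -- boundedness for each fixed `k`, and with `k` in the input
    (∀ k : ℕ, ComputablePred fun A : FinNFA => A.AbsBounded k) ∧
    (ComputablePred fun p : FinNFA × ℕ => p.1.AbsBounded p.2) ∧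
    -- universal boundedness for each fixed `k`, and with `k` in the input
    (∀ k : ℕ, ComputablePred fun A : FinNFA => A.UnivAbsBounded k) ∧
    (ComputablePred fun p : FinNFA × ℕ => p.1.UnivAbsBounded p.2) := by
  obtain ⟨B, hB, hspec⟩ := FinNFA.exists_computable_isCostNFA
  have hfix : ∀ k : ℕ, Primrec fun A : FinNFA => (A, k) := fun k =>
    Primrec.id.pair (Primrec.const k)
  exact ⟨⟨B, hB, fun A k => (hspec (A, k)).mem_accepts_iff⟩,
    fun k => (FinNFA.primrecPred_absBounded.comp (hfix k)).computablePred,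
    FinNFA.primrecPred_absBounded.computablePred,
    fun k => (FinNFA.primrecPred_univAbsBounded.comp (hfix k)).computablePred,
    FinNFA.primrecPred_univAbsBounded.computablePred⟩
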